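/- Let $G=(V,E)$ be a finite bipartite graph, and for every vertex $u\in V$ let an arbitrary linear order on the other vertices, the preference order of $u$, be fixed. Random Decision Order (RDO) samples a linear order of $V$ (the decision order) uniformly at random and processes the vertices in that order. When $u$ is processed, the pairs $(u,v)$ with $v\neq u$ are probed one by one in the preference order of $u$; whenever a probed pair is an edge of $G$ and both its endpoints are still unmatched, the edge is added to the matching, and otherwise nothing happens. Then RDO is $0.639$-approximate: if $M$ denotes the random matching produced by RDO and $M^*$ is a maximum matching of $G$, then $$\mathbb{E}\bigl[|M|\bigr]\;\ge\;0.639\cdot|M^*| .$$ -/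

import Mathlib

open scoped BigOperators

namespace ObliviousMatching

/-- One probe of the query-commit model. `M` is the set of edges matched so far. If the probed pair
is an edge of `G` and both its vertices are still unmatched, the pair is irrevocably matched;
otherwise nothing happens. -/
def probe {V : Type*} [DecidableEq V] (G : SimpleGraph V) [DecidableRel G.Adj]
    (M : Finset (Sym2 V)) (p : V × V) : Finset (Sym2 V) :=
  if G.Adj p.1 p.2 ∧ ∀ e ∈ M, p.1 ∉ e ∧ p.2 ∉ e then insert s(p.1, p.2) M else M

/-- The matching obtained by probing the pairs of a list one by one, starting with no matched
edge. -/
def greedyMatching {V : Type*} [DecidableEq V] (G : SimpleGraph V) [DecidableRel G.Adj]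
    (L : List (V × V)) : Finset (Sym2 V) :=
  L.foldl (probe G) ∅

/-- A linear order on the finite vertex set `V`, given as the enumeration of all its elements
from first to last. -/
abbrev VertexOrder (V : Type*) [Fintype V] : Type _ := Fin (Fintype.card V) ≃ V

/-- The sequence of probes of a vertex-iterative algorithm. It depends on the decision order
and on the preference orders, but not on the edges of the graph. The vertices are
processed in the decision order, and in the iteration of `u` the vertex `u` is probed with all
the other vertices, in the order in which they appear in the preference order `pref u`. -/
def probeSequence {V : Type*} [Fintype V] [DecidableEq V] (order : VertexOrder V)
    (pref : V → VertexOrder V) : List (V × V) :=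
  (List.ofFn order).flatMap fun u =>
    ((List.ofFn (pref u)).filter fun v => v ≠ u).map fun v => (u, v)

/-- The matching produced by Random Decision Order when `order` is the sampled decision order. -/
def rdoMatching {V : Type*} [Fintype V] [DecidableEq V] (G : SimpleGraph V) [DecidableRel G.Adj]
    (pref : V → VertexOrder V) (order : VertexOrder V) : Finset (Sym2 V) :=
  greedyMatching G (probeSequence order pref)

/-- The expected size of the matching produced by Random Decision Order: the average, over all
decision orders (each having the same probability), of the number of matched edges. -/
noncomputable def rdoExpectedSize {V : Type*} [Fintype V] [DecidableEq V] (G : SimpleGraph V)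
    [DecidableRel G.Adj] (pref : V → VertexOrder V) : ℝ :=
  Finset.expect Finset.univ fun order : VertexOrder V => ((rdoMatching G pref order).card : ℝ)

/-- `M` is a matching of `G` with the largest possible number of edges. -/
def IsMaximumMatching {V : Type*} {G : SimpleGraph V} (M : G.Subgraph) : Prop :=
  M.IsMatching ∧ ∀ M' : G.Subgraph, M'.IsMatching → M'.edgeSet.ncard ≤ M.edgeSet.ncard

end ObliviousMatching

/-! Give the vertices independent uniform times in {0, …, N - 1} and break ties by a uniform order.
Sorting by time then yields exactly the uniform decision order (`sum_timedOrder`), and expectations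
become double sums that approximate integrals. Each matched pair splits one unit: the active vertex,
processed at time x, keeps `share (x / N)` and its partner gets the rest (`gain`). Edges of a
matching are disjoint, so it suffices that the two ends of one edge uv receive at least 0.639 - 8/N
on average over their own times, all other times being fixed (`sum_gain_edge_ge`). Then N tends to
infinity.

Consider the process without v. There u finds a partner as an active vertex exactly when its time is
below a threshold D. If u is still unmatched at time D, it has no unmatched neighbour left and never
will be matched. Bipartiteness transfers this to the full graph: adding v leaves fewer unmatched
vertices on the side of u (`Dominates.run`), so u is matched no later than without v. As `share` is
nondecreasing and at most 1/2, u receives at least `share (x / N)` if x < D, and at least `1 - share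
(D / N)` after D if it can be matched passively (`guarantee_le_gain`). The same holds for v with a
threshold E.

These guarantees are too weak when one end, say u, is never matched passively. The remedy: if u is
processed at a time x ≥ D before v, and v is still free, then v is the only partner available to u,
so the pair gains a whole unit (`one_le_gain_of_fails`).

What remains is a minimisation over the rescaled thresholds d ≤ e. If both ends can be matched
passively, crude bounds suffice; otherwise the average is close to `mixedValue` or `activeValue`,
and the piecewise polynomial `share` keeps both of these above 0.639. -/

namespace ObliviousMatching

/-! ### The algorithm as a process on the set of unmatched vertices. -/

section Run

variable {V : Type*} [DecidableEq V] (G : SimpleGraph V) [DecidableRel G.Adj] (pl : V → List V)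

/-- The partner chosen by `u` when the set of unmatched vertices is `S`: the first unmatched
neighbour in the list `pl u`, provided that `u` itself is unmatched. -/
def choice (S : Finset V) (u : V) : Option V :=
  if u ∈ S then (pl u).find? fun w => decide (G.Adj u w ∧ w ∈ S) else none

/-- The set of unmatched vertices after `u` is processed. -/
def step (S : Finset V) (u : V) : Finset V :=
  match choice G pl S u with
  | none => S
  | some w => (S.erase u).erase w

/-- The set of unmatched vertices after the vertices of a list are processed. -/
def run (S : Finset V) (L : List V) : Finset V := L.foldl (step G pl) S

/-- The number of pairs matched while a list of vertices is processed. -/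
def size : Finset V → List V → ℕ
  | _, [] => 0
  | S, u :: L =>
    match choice G pl S u with
    | none => size S L
    | some w => size ((S.erase u).erase w) L + 1

/-- The share of `x` when each matched pair divides one unit: the active vertex `u` gets `c u` and
the passive one the rest. -/
def gain (c : V → ℝ) : Finset V → List V → V → ℝ
  | _, [], _ => 0
  | S, u :: L, x =>
    match choice G pl S u with
    | none => gain c S L x
    | some w => (if x = u then c u else 0) + (if x = w then 1 - c u else 0) +
        gain c ((S.erase u).erase w) L x

variable {G pl}

theorem choice_eq_some {S : Finset V} {u w : V} (h : choice G pl S u = some w) :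
    u ∈ S ∧ G.Adj u w ∧ w ∈ S := by
  unfold choice at h
  split_ifs at h with hu
  have := List.find?_some h
  simp only [decide_eq_true_eq] at this
  exact ⟨hu, this⟩

theorem choice_eq_none {S : Finset V} {u w : V} (hpl : w ∈ pl u) (h : choice G pl S u = none)
    (hu : u ∈ S) (hw : G.Adj u w) : w ∉ S := by
  unfold choice at h
  rw [if_pos hu, List.find?_eq_none] at h
  intro hS
  exact h w hpl (by simp [hw, hS])

theorem choice_of_notMem {S : Finset V} {u : V} (hu : u ∉ S) : choice G pl S u = none := by
  simp [choice, hu]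

/-- The choice is unaffected by the removal of other candidates. -/
theorem choice_of_subset {S T : Finset V} {u w : V} (hu : u ∈ S)
    (hST : ∀ z, G.Adj u z → z ∈ S → z ∈ T) (h : choice G pl T u = some w) (hw : w ∈ S) :
    choice G pl S u = some w := by
  obtain ⟨huT, hadj, -⟩ := choice_eq_some h
  unfold choice at h ⊢
  rw [if_pos huT] at h
  rw [if_pos hu]
  generalize pl u = l at h
  induction l with
  | nil => simp at h
  | cons z l ih =>
    rw [List.find?_cons] at h ⊢
    by_cases hz : G.Adj u z ∧ z ∈ T
    · simp only [hz, and_self, decide_true, Option.some.injEq] at h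
      subst h
      simp [hadj, hw]
    · have hz' : ¬ (G.Adj u z ∧ z ∈ S) := fun h' => hz ⟨h'.1, hST z h'.1 h'.2⟩
      simp only [hz, decide_false] at h
      simp only [hz', decide_false]
      exact ih h

theorem mem_step {S : Finset V} {u x : V} :
    x ∈ step G pl S u ↔ x ∈ S ∧ ∀ w, choice G pl S u = some w → x ≠ u ∧ x ≠ w := by
  unfold step
  rcases h : choice G pl S u with _ | w
  · simp
  · simp only [Finset.mem_erase, Option.some.injEq, forall_eq']
    tauto

theorem step_subset (S : Finset V) (u : V) : step G pl S u ⊆ S := fun _ hx => (mem_step.1 hx).1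

theorem run_cons (S : Finset V) (u : V) (L : List V) :
    run G pl S (u :: L) = run G pl (step G pl S u) L := rfl

theorem run_append (S : Finset V) (L₁ L₂ : List V) :
    run G pl S (L₁ ++ L₂) = run G pl (run G pl S L₁) L₂ := List.foldl_append

theorem run_subset (S : Finset V) (L : List V) : run G pl S L ⊆ S := by
  induction L generalizing S with
  | nil => exact subset_rfl
  | cons u L ih => exact (ih _).trans (step_subset S u)

theorem step_of_notMem {S : Finset V} {u : V} (hu : u ∉ S) : step G pl S u = S := by
  simp [step, choice_of_notMem hu]

/-- Processing a vertex that is absent from the start has no effect. -/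
theorem run_filter_ne {S : Finset V} {v : V} (hv : v ∉ S) (L : List V) :
    run G pl S (L.filter (· ≠ v)) = run G pl S L := by
  induction L generalizing S with
  | nil => rfl
  | cons u L ih =>
    by_cases h : u = v
    · subst h
      rw [List.filter_cons_of_neg (by simp), run_cons, step_of_notMem hv, ih hv]
    · rw [List.filter_cons_of_pos (by simpa using h), run_cons, run_cons,
        ih fun h' => hv (step_subset S u h')]

/-- An unmatched vertex without unmatched neighbours stays unmatched. -/
theorem mem_run_of_isolated {S : Finset V} {u : V} (hu : u ∈ S)
    (h : ∀ w, G.Adj u w → w ∉ S) (L : List V) : u ∈ run G pl S L := by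
  induction L generalizing S with
  | nil => exact hu
  | cons z L ih =>
    refine ih (mem_step.2 ⟨hu, fun w hw => ?_⟩) fun w hw hS => h w hw (step_subset S z hS)
    obtain ⟨hz, hadj, hwS⟩ := choice_eq_some hw
    exact ⟨fun e => h w (e ▸ hadj) hwS, fun e => h z (e ▸ hadj.symm) hz⟩

/-- `T` is at least `S` on the side `A` of the graph and at most `S` on the other side. -/
def Dominates (A : V → Prop) (S T : Finset V) : Prop :=
  (∀ x, A x → x ∈ S → x ∈ T) ∧ ∀ x, ¬ A x → x ∈ T → x ∈ S

/-- All candidates of `u` lie on the side opposite to `u`, where one of the two sets contains the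
other. The choice made from the larger candidate set is also made from the smaller one whenever it
is still there, and a choice from the smaller set forces some choice from the larger one. So no
removal can break either inclusion. -/
theorem Dominates.step {A : V → Prop} (hA : ∀ u w, G.Adj u w → (A u ↔ ¬ A w))
    (hpl : ∀ u w, w ∈ pl u) {S T : Finset V} (h : Dominates A S T) (u : V) :
    Dominates A (step G pl S u) (step G pl T u) := by
  obtain ⟨h1, h2⟩ := h
  by_cases hAu : A u
  · have key : ∀ w, choice G pl S u = some w → w ∈ T → choice G pl T u = some w := by
      intro w hw hwT
      refine choice_of_subset (h1 u hAu (choice_eq_some hw).1) ?_ hw hwT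
      exact fun z hz hzT => h2 z ((hA u z hz).1 hAu) hzT
    have key2 : ∀ w, choice G pl T u = some w → u ∈ S → ∃ z, choice G pl S u = some z := by
      intro w hw huS
      obtain ⟨-, hadj, hwT⟩ := choice_eq_some hw
      rcases hc : choice G pl S u with _ | z
      · exact absurd (h2 w ((hA u w hadj).1 hAu) hwT) (choice_eq_none (hpl u w) hc huS hadj)
      · exact ⟨z, rfl⟩
    refine ⟨fun x hx hxS => ?_, fun x hx hxT => ?_⟩
    · rw [mem_step] at hxS ⊢
      refine ⟨h1 x hx hxS.1, fun w hw => ⟨?_, ?_⟩⟩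
      · rintro rfl
        obtain ⟨z, hz⟩ := key2 w hw hxS.1
        exact (hxS.2 z hz).1 rfl
      · rintro rfl
        exact (hA u x (choice_eq_some hw).2.1).1 hAu hx
    · rw [mem_step] at hxT ⊢
      refine ⟨h2 x hx hxT.1, fun w hw => ⟨?_, ?_⟩⟩
      · rintro rfl
        exact hx hAu
      · rintro rfl
        exact (hxT.2 x (key x hw hxT.1)).2 rfl
  · have hside : ∀ z, G.Adj u z → A z := fun z hz => by
      by_contra hAz
      exact hAu ((hA u z hz).2 hAz)
    have key : ∀ w, choice G pl T u = some w → w ∈ S → choice G pl S u = some w := by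
      intro w hw hwS
      refine choice_of_subset (h2 u hAu (choice_eq_some hw).1) ?_ hw hwS
      exact fun z hz hzS => h1 z (hside z hz) hzS
    have key2 : ∀ w, choice G pl S u = some w → u ∈ T → ∃ z, choice G pl T u = some z := by
      intro w hw huT
      obtain ⟨-, hadj, hwS⟩ := choice_eq_some hw
      rcases hc : choice G pl T u with _ | z
      · exact absurd (h1 w (hside w hadj) hwS) (choice_eq_none (hpl u w) hc huT hadj)
      · exact ⟨z, rfl⟩
    refine ⟨fun x hx hxS => ?_, fun x hx hxT => ?_⟩
    · rw [mem_step] at hxS ⊢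
      refine ⟨h1 x hx hxS.1, fun w hw => ⟨?_, ?_⟩⟩
      · rintro rfl
        exact hAu hx
      · rintro rfl
        exact (hxS.2 x (key x hw hxS.1)).2 rfl
    · rw [mem_step] at hxT ⊢
      refine ⟨h2 x hx hxT.1, fun w hw => ⟨?_, ?_⟩⟩
      · rintro rfl
        obtain ⟨z, hz⟩ := key2 w hw hxT.1
        exact (hxT.2 z hz).1 rfl
      · rintro rfl
        exact hx (hside x (choice_eq_some hw).2.1)

/-- In a bipartite graph, additional vertices on one side leave that side with more unmatched
vertices and the other side with fewer, at every moment. -/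
theorem Dominates.run {A : V → Prop} (hA : ∀ u w, G.Adj u w → (A u ↔ ¬ A w))
    (hpl : ∀ u w, w ∈ pl u) {S T : Finset V} (h : Dominates A S T) (L : List V) :
    Dominates A (run G pl S L) (run G pl T L) := by
  induction L generalizing S T with
  | nil => exact h
  | cons u L ih => exact ih (h.step hA hpl u)

/-- As long as neither of two vertices is matched in the absence of the other, they do not
influence the process. -/
theorem run_eq_insert {S : Finset V} {u v : V} (hu : u ∈ S) (hv : v ∈ S) (huv : u ≠ v)
    {L : List V} (huL : u ∉ L) (hvL : v ∉ L) (h1 : u ∈ run G pl (S.erase v) L)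
    (h2 : v ∈ run G pl (S.erase u) L) :
    run G pl S L = insert v (run G pl (S.erase v) L) := by
  induction L generalizing S with
  | nil => simp [run, Finset.insert_erase hv]
  | cons z L ih =>
    simp only [List.mem_cons, not_or] at huL hvL
    rw [run_cons] at h1 h2 ⊢
    rw [run_cons]
    rcases hc : choice G pl S z with _ | w
    · have hn : ∀ x, choice G pl (S.erase x) z = none := by
        intro x
        rcases hx : choice G pl (S.erase x) z with _ | y
        · rfl
        · exfalso
          obtain ⟨ha, hb, hd⟩ := choice_eq_some hx
          unfold choice at hc hx
          rw [if_pos (Finset.mem_of_mem_erase ha), List.find?_eq_none] at hc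
          rw [if_pos ha] at hx
          exact hc y (List.mem_of_find?_eq_some hx) (by simp [hb, Finset.mem_of_mem_erase hd])
      have e1 : step G pl S z = S := by simp [step, hc]
      have e2 : ∀ x, step G pl (S.erase x) z = S.erase x := fun x => by simp [step, hn]
      rw [e2] at h1 h2 ⊢
      rw [e1]
      exact ih hu hv huL.2 hvL.2 h1 h2
    · obtain ⟨hz, hadj, hw⟩ := choice_eq_some hc
      have hr : ∀ x, z ≠ x → w ≠ x → choice G pl (S.erase x) z = some w := fun x hzx hwx =>
        choice_of_subset (Finset.mem_erase.2 ⟨hzx, hz⟩)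
          (fun y _ hy => Finset.mem_of_mem_erase hy) hc (Finset.mem_erase.2 ⟨hwx, hw⟩)
      -- If `z` took `v`, it would also take `v` in the absence of `u`, contrary to `h2`.
      have hwv : w ≠ v := by
        rintro rfl
        exact (mem_step.1 (run_subset _ _ h2)).2 w (hr u (Ne.symm huL.1) huv.symm) |>.2 rfl
      have hwu : w ≠ u := by
        rintro rfl
        exact (mem_step.1 (run_subset _ _ h1)).2 w (hr v (Ne.symm hvL.1) huv) |>.2 rfl
      have e1 : step G pl S z = (S.erase z).erase w := by simp [step, hc]
      have e2 : ∀ x, z ≠ x → w ≠ x → step G pl (S.erase x) z = ((S.erase z).erase w).erase x := by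
        intro x hzx hwx
        simp only [step, hr x hzx hwx]
        ext y
        simp only [Finset.mem_erase]
        tauto
      rw [e2 v (Ne.symm hvL.1) hwv] at h1 ⊢
      rw [e2 u (Ne.symm huL.1) hwu] at h2
      rw [e1]
      refine ih ?_ ?_ huL.2 hvL.2 h1 h2
      · simp [hu, huL.1, hwu.symm]
      · simp [hv, hvL.1, hwv.symm]

/-! ### Sharing the unit of each matched pair. -/

section Gain

variable {c : V → ℝ}

theorem gain_nonneg (hc : ∀ x, 0 ≤ c x ∧ c x ≤ 1) (S : Finset V) (L : List V) (x : V) :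
    0 ≤ gain G pl c S L x := by
  induction L generalizing S with
  | nil => simp [gain]
  | cons u L ih =>
    unfold gain
    split
    · exact ih _
    · have := hc u
      have := ih ((S.erase u).erase ‹_›)
      split_ifs <;> linarith

theorem sum_gain [Fintype V] (S : Finset V) (L : List V) :
    ∑ x, gain G pl c S L x = size G pl S L := by
  induction L generalizing S with
  | nil => simp [gain, size]
  | cons u L ih =>
    unfold gain size
    split
    · exact ih S
    · simp [Finset.sum_add_distrib, ih, add_comm]

theorem gain_append (S : Finset V) (L₁ L₂ : List V) (x : V) :
    gain G pl c S (L₁ ++ L₂) x = gain G pl c S L₁ x + gain G pl c (run G pl S L₁) L₂ x := by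
  induction L₁ generalizing S with
  | nil => simp [gain, run]
  | cons u L ih =>
    rw [List.cons_append, run_cons]
    rcases h : choice G pl S u with _ | w
    · simp only [gain, step, h]
      exact ih S
    · simp only [gain, step, h, ih]
      ring

theorem le_gain_of_prefix (hc : ∀ x, 0 ≤ c x ∧ c x ≤ 1) (S : Finset V) (L₁ L₂ : List V) (x : V) :
    gain G pl c S L₁ x ≤ gain G pl c S (L₁ ++ L₂) x := by
  rw [gain_append]
  linarith [gain_nonneg (G := G) (pl := pl) hc (run G pl S L₁) L₂ x]

/-- The share of a matched vertex, in terms of bounds on the shares of the active vertices. -/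
theorem le_gain_of_matched (hc : ∀ x, 0 ≤ c x ∧ c x ≤ 1) {S : Finset V} {L : List V} {x : V}
    {κ : ℝ} (hx : x ∈ S) (hx' : x ∉ run G pl S L) (hκ : ∀ z ∈ L, κ ≤ 1 - c z)
    (hκ' : x ∈ L → κ ≤ c x) : κ ≤ gain G pl c S L x := by
  induction L generalizing S with
  | nil => exact absurd hx hx'
  | cons u L ih =>
    rw [run_cons] at hx'
    simp only [List.mem_cons, forall_eq_or_imp] at hκ hκ'
    unfold gain
    unfold step at hx'
    rcases hch : choice G pl S u with _ | w
    · rw [hch] at hx'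
      exact ih hx hx' hκ.2 fun h => hκ' (Or.inr h)
    · rw [hch] at hx'
      simp only at hx' ⊢
      have h0 := gain_nonneg (G := G) (pl := pl) hc ((S.erase u).erase w) L x
      have hu := hc u
      by_cases h1 : x = u
      · rw [if_pos h1]
        have := hκ' (Or.inl h1)
        rw [h1] at this
        split_ifs <;> linarith
      · by_cases h2 : x = w
        · rw [if_pos h2, if_neg h1]
          linarith [hκ.1]
        · rw [if_neg h1, if_neg h2]
          simpa using ih (by simp [hx, h1, h2]) hx' hκ.2 fun h => hκ' (Or.inr h)

/-- Two vertices that are matched with each other share one unit. -/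
theorem one_le_gain_add_gain (hc : ∀ x, 0 ≤ c x ∧ c x ≤ 1) {S : Finset V} {L₁ L₂ : List V}
    {u v : V} (h : choice G pl (run G pl S L₁) u = some v) :
    1 ≤ gain G pl c S (L₁ ++ u :: L₂) u + gain G pl c S (L₁ ++ u :: L₂) v := by
  have huv : u ≠ v := (choice_eq_some h).2.1.ne
  have hn := gain_nonneg (G := G) (pl := pl) hc
  simp only [gain_append, gain, h, if_true, if_neg huv, if_neg huv.symm]
  have := hn S L₁ u
  have := hn S L₁ v
  have := hn (((run G pl S L₁).erase u).erase v) L₂ u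
  have := hn (((run G pl S L₁).erase u).erase v) L₂ v
  linarith

end Gain

end Run

/-! ### The sharing function and the two minimisation problems over thresholds. -/

section Share

/-- The share of an active vertex that is processed at time `x`. -/
noncomputable def share (x : ℝ) : ℝ :=
  9 / 25 + 9 / 100 * min x (3 / 5) + 3 / 10 * min x (3 / 5) ^ 3

/-- The integral of `share` from `0` to `x`. -/
noncomputable def shareInt (x : ℝ) : ℝ :=
  9 / 25 * min x (3 / 5) + 9 / 200 * min x (3 / 5) ^ 2 + 3 / 40 * min x (3 / 5) ^ 4 +
    1197 / 2500 * (x - min x (3 / 5))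

/-- The integral of `y * share y` from `0` to `x`. -/
noncomputable def shareMoment (x : ℝ) : ℝ :=
  9 / 50 * min x (3 / 5) ^ 2 + 3 / 100 * min x (3 / 5) ^ 3 + 3 / 50 * min x (3 / 5) ^ 5 +
    1197 / 5000 * (x ^ 2 - min x (3 / 5) ^ 2)

theorem share_of_le {x : ℝ} (h : x ≤ 3 / 5) : share x = 9 / 25 + 9 / 100 * x + 3 / 10 * x ^ 3 := by
  rw [share, min_eq_left h]

theorem share_of_ge {x : ℝ} (h : 3 / 5 ≤ x) : share x = 1197 / 2500 := by
  rw [share, min_eq_right h]; norm_num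

theorem shareInt_of_le {x : ℝ} (h : x ≤ 3 / 5) :
    shareInt x = 9 / 25 * x + 9 / 200 * x ^ 2 + 3 / 40 * x ^ 4 := by
  rw [shareInt, min_eq_left h]; ring

theorem shareInt_of_ge {x : ℝ} (h : 3 / 5 ≤ x) :
    shareInt x = 6048 / 25000 + 1197 / 2500 * (x - 3 / 5) := by
  rw [shareInt, min_eq_right h]; ring

theorem shareMoment_of_le {x : ℝ} (h : x ≤ 3 / 5) :
    shareMoment x = 9 / 50 * x ^ 2 + 3 / 100 * x ^ 3 + 3 / 50 * x ^ 5 := by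
  rw [shareMoment, min_eq_left h]; ring

theorem shareMoment_of_ge {x : ℝ} (h : 3 / 5 ≤ x) :
    shareMoment x = 47466 / 625000 + 1197 / 5000 * (x ^ 2 - 9 / 25) := by
  rw [shareMoment, min_eq_right h]; ring

theorem share_mono {x y : ℝ} (hx : 0 ≤ x) (hxy : x ≤ y) : share x ≤ share y := by
  have h : min x (3 / 5) ≤ min y (3 / 5) := min_le_min_right _ hxy
  have h0 : 0 ≤ min x (3 / 5 : ℝ) := le_min hx (by norm_num)
  unfold share
  gcongr

theorem le_share {x : ℝ} (hx : 0 ≤ x) : 9 / 25 ≤ share x := by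
  have h0 : 0 ≤ min x (3 / 5 : ℝ) := le_min hx (by norm_num)
  unfold share
  have := pow_nonneg h0 3
  linarith

theorem share_le {x : ℝ} (hx : 0 ≤ x) : share x ≤ 1 / 2 := by
  rcases le_total x (3 / 5) with h | h
  · have := share_mono hx h
    rw [share_of_ge le_rfl] at this
    linarith
  · rw [share_of_ge h]
    norm_num

/-- The value of the sharing scheme when `u` is never matched passively, `v` is, and the thresholds
are `d` and `e`. -/
noncomputable def mixedValue (d e : ℝ) : ℝ :=
  shareInt d + shareInt e + (1 - e) * (1 - share e) + (e - d) ^ 2 / 2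
    - (shareMoment e - shareMoment d - d * (shareInt e - shareInt d))
    + (1 - e) * (e - d) * share e

/-- The value of the sharing scheme when neither vertex is ever matched passively. -/
noncomputable def activeValue (d e : ℝ) : ℝ :=
  shareInt d + shareInt e + (1 - d) ^ 2 / 2 + (1 - e) ^ 2 / 2
    - (shareMoment e - shareMoment d - d * (shareInt e - shareInt d))

/-- This is what `mixedValue_of_le` needs once `d` is optimised away: the constant is 16/25 -
639/1000, and the coefficients of e², e⁴ and e⁵ are lowered slightly, to pay for the completed
square and for rounding. -/
theorem quintic_bound {e : ℝ} (h1 : e ≤ 3 / 5) :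
    0 ≤ 1 / 1000 - e / 100 + 912 / 10000 * e ^ 2 - 567 / 1600 * e ^ 3 + 5223 / 10000 * e ^ 4
      - 173 / 1000 * e ^ 5 := by
  nlinarith [sq_nonneg (5455 / 10000 * e ^ 2 - 2388 / 10000 * e + 18 / 1000),
    mul_nonneg (mul_nonneg (sq_nonneg e) (sub_nonneg.2 h1)) (sq_nonneg (e - 7 / 20)),
    sq_nonneg (e - 7 / 19)]

theorem mixedValue_of_le {d e : ℝ} (hd : 0 ≤ d) (hde : d ≤ e) (he : e ≤ 3 / 5) :
    639 / 1000 ≤ mixedValue d e := by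
  -- Centering `d` at e/2 makes the coefficient of `s` small.
  obtain ⟨s, rfl⟩ : ∃ s, d = e / 2 - s := ⟨e / 2 - d, by ring⟩
  have he0 : 0 ≤ e := hd.trans hde
  have e1 : mixedValue (e / 2 - s) e = (16 / 25 - e / 100 + 73 / 800 * e ^ 2 - 567 / 1600 * e ^ 3
      + 339 / 640 * e ^ 4 - 1107 / 6400 * e ^ 5)
      + s * (1 / 200 * e - 99 / 800 * e ^ 2 + 21 / 80 * e ^ 3 - 237 / 640 * e ^ 4)
      + s ^ 2 * (73 / 200 - 9 / 400 * e + 9 / 80 * e ^ 2 - 3 / 160 * e ^ 3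
        + s * (3 / 200 - 3 / 20 * e + 3 / 80 * e ^ 2) + s ^ 2 * (3 / 40 - 3 / 80 * e)
        + 3 / 200 * s ^ 3) := by
    rw [mixedValue, shareInt_of_le he, shareInt_of_le (hde.trans he), shareMoment_of_le he,
      shareMoment_of_le (hde.trans he), share_of_le he]
    ring
  have hs1 : s ≤ e / 2 := by linarith
  have hs2 : -(e / 2) ≤ s := by linarith
  have hK : 17 / 50 ≤ 73 / 200 - 9 / 400 * e + 9 / 80 * e ^ 2 - 3 / 160 * e ^ 3
        + s * (3 / 200 - 3 / 20 * e + 3 / 80 * e ^ 2) + s ^ 2 * (3 / 40 - 3 / 80 * e)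
        + 3 / 200 * s ^ 3 := by
    have t1 : |s * (3 / 200 - 3 / 20 * e + 3 / 80 * e ^ 2)| ≤ 3 / 10 * (63 / 1000) := by
      rw [abs_mul]
      exact mul_le_mul (abs_le.2 ⟨by linarith, by linarith⟩)
        (abs_le.2 ⟨by nlinarith, by nlinarith⟩) (abs_nonneg _) (by norm_num)
    have t2 : |s ^ 3| ≤ (3 / 10) ^ 3 := by
      rw [abs_pow]
      exact pow_le_pow_left₀ (abs_nonneg s) (abs_le.2 ⟨by linarith, by linarith⟩) 3
    have t3 : 0 ≤ s ^ 2 * (3 / 40 - 3 / 80 * e) := mul_nonneg (sq_nonneg s) (by linarith)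
    have t4 : 0 ≤ e ^ 2 * (3 / 5 - e) := mul_nonneg (sq_nonneg e) (by linarith)
    have t5 := (abs_le.1 t1).1
    have t6 := (abs_le.1 t2).1
    have t7 : 0 ≤ (e - 1 / 9) ^ 2 := sq_nonneg _
    linarith
  have hq : (1 / 200 * e - 99 / 800 * e ^ 2 + 21 / 80 * e ^ 3 - 237 / 640 * e ^ 4) ^ 2
      ≤ e ^ 2 * (1 / 40000 + e ^ 2 / 100) := by
    -- The coefficient of `s` is `-e * k`.
    set k := -(1 / 200) + 99 / 800 * e - 21 / 80 * e ^ 2 + 237 / 640 * e ^ 3 with hk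
    have h1 : -(1 / 200) ≤ k := by
      nlinarith [mul_nonneg he0 (sub_nonneg.2 he), mul_nonneg he0 (sq_nonneg (e - 7 / 20))]
    have h2 : k ≤ e / 10 := by
      nlinarith [mul_nonneg he0 (sub_nonneg.2 he), mul_nonneg (sq_nonneg e) (sub_nonneg.2 he)]
    have h3 : k ^ 2 ≤ 1 / 40000 + e ^ 2 / 100 := by
      rcases le_total 0 k with h | h <;> nlinarith
    calc _ = e ^ 2 * k ^ 2 := by rw [hk]; ring
      _ ≤ _ := mul_le_mul_of_nonneg_left h3 (sq_nonneg e)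
  have hQ := quintic_bound he
  rw [e1]
  generalize 1 / 200 * e - 99 / 800 * e ^ 2 + 21 / 80 * e ^ 3 - 237 / 640 * e ^ 4 = q at hq
  have h5 : 0 ≤ e ^ 5 := by positivity
  have h4 : 0 ≤ e ^ 4 := by positivity
  have hm := mul_le_mul_of_nonneg_left hK (sq_nonneg s)
  -- Here 17/25 is twice the lower bound 17/50 of `hK`: completing the square in `s` costs 25/34 ·
  -- q², which `hq` and `hQ` cover.
  have h7 := sq_nonneg (17 / 25 * s + q)
  linarith [sq_nonneg e]

theorem activeValue_of_le {d e : ℝ} (hd : 0 ≤ d) (hde : d ≤ e) (he : e ≤ 3 / 5) :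
    639 / 1000 ≤ activeValue d e := by
  obtain ⟨s, rfl⟩ : ∃ s, d = e - s := ⟨e - d, by ring⟩
  have he0 : 0 ≤ e := hd.trans hde
  have e1 : activeValue (e - s) e = (1 - 32 / 25 * e + 109 / 100 * e ^ 2 + 3 / 20 * e ^ 4)
      + s * (16 / 25 - 109 / 100 * e - 3 / 10 * e ^ 3)
      + s ^ 2 * (73 / 200 - 9 / 200 * e + 9 / 20 * e ^ 2 - 3 / 20 * e ^ 3
        + s * (3 / 200 - 3 / 10 * e + 3 / 20 * e ^ 2) + s ^ 2 * (3 / 40 - 3 / 40 * e)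
        + 3 / 200 * s ^ 3) := by
    rw [activeValue, shareInt_of_le he, shareInt_of_le (hde.trans he), shareMoment_of_le he,
      shareMoment_of_le (hde.trans he)]
    ring
  have hs0 : 0 ≤ s := by linarith
  have hs1 : s ≤ e := by linarith
  rw [e1]
  have hK : 73 / 200 - 9 / 200 * e + e ^ 2 / 5 ≤ 73 / 200 - 9 / 200 * e + 9 / 20 * e ^ 2
        - 3 / 20 * e ^ 3 + s * (3 / 200 - 3 / 10 * e + 3 / 20 * e ^ 2)
        + s ^ 2 * (3 / 40 - 3 / 40 * e) + 3 / 200 * s ^ 3 := by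
    have t1 : 0 ≤ s * (3 / 40) * (s * (2 / 5)) := by positivity
    have t2 : 0 ≤ s * s * (3 / 5 - e) := mul_nonneg (mul_nonneg hs0 hs0) (by linarith)
    have t3 : 0 ≤ s ^ 3 := by positivity
    nlinarith [mul_nonneg he0 (sub_nonneg.2 hs1), mul_nonneg (sq_nonneg e) (sub_nonneg.2 hs1),
      mul_nonneg (sq_nonneg e) (sub_nonneg.2 he), sq_nonneg (e - s), mul_nonneg he0 hs0]
  have hQ : 639 / 1000 ≤ 1 - 32 / 25 * e + 109 / 100 * e ^ 2 + 3 / 20 * e ^ 4 := by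
    nlinarith [sq_nonneg (e ^ 2 - 295 / 1000), sq_nonneg (e - 543 / 1000)]
  -- Up to about 0.54 the coefficient of `s` is nonnegative, and both terms with `s` can be dropped.
  -- Beyond, this concave coefficient is bounded below by its rounded chord on [0.54, 0.6], and the
  -- square in `s` is completed with 0.796 = 2 · 0.398.
  rcases le_total e (54 / 100) with h | h
  · have hq : 0 ≤ 16 / 25 - 109 / 100 * e - 3 / 10 * e ^ 3 := by
      have := pow_le_pow_left₀ he0 h 3
      linarith
    have := mul_nonneg hs0 hq
    have := mul_nonneg (sq_nonneg s) (le_trans (by nlinarith) hK)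
    linarith
  · have hq : 16 / 25 - 109 / 100 * e - 3 / 10 * e ^ 3 ≥ 75083 / 100000 - 13828 / 10000 * e := by
      nlinarith [mul_nonneg (sub_nonneg.2 h) (sub_nonneg.2 he)]
    have := mul_le_mul_of_nonneg_left hq hs0
    have := mul_le_mul_of_nonneg_left (le_trans (show (398 / 1000 : ℝ) ≤ _ by nlinarith) hK) (sq_nonneg s)
    nlinarith [sq_nonneg (796 / 1000 * s + (75083 / 100000 - 13828 / 10000 * e)), sq_nonneg (e ^ 2 - 32 / 100)]

/-- Beyond 3/5 `share` is constant, so for d ≤ 3/5 the increment over the value at e = 3/5 is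
explicit and nonnegative. -/
theorem mixedValue_of_ge {d e : ℝ} (hd : 0 ≤ d) (hde : d ≤ e) (he : 3 / 5 ≤ e) (he1 : e ≤ 1) :
    639 / 1000 ≤ mixedValue d e := by
  rcases le_total d (3 / 5) with h | h
  · have h1 := mixedValue_of_le hd h le_rfl
    have h2 : mixedValue d e = mixedValue d (3 / 5)
        + (e - 3 / 5) * (1091 / 2500 * (2 / 5 - (e - 3 / 5) / 2) - 53 / 1250 * d) := by
      simp only [mixedValue, shareInt_of_ge he, shareInt_of_ge le_rfl, shareMoment_of_ge he,
        shareMoment_of_ge le_rfl, share_of_ge he, share_of_ge le_rfl]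
      ring
    have : 0 ≤ (e - 3 / 5) * (1091 / 2500 * (2 / 5 - (e - 3 / 5) / 2) - 53 / 1250 * d) :=
      mul_nonneg (by linarith) (by linarith)
    linarith
  · simp only [mixedValue, shareInt_of_ge he, shareInt_of_ge h, shareMoment_of_ge he,
      shareMoment_of_ge h, share_of_ge he]
    nlinarith [mul_nonneg (sub_nonneg.2 hde) (sub_nonneg.2 he1),
      mul_nonneg (sub_nonneg.2 h) (sub_nonneg.2 he1), sq_nonneg (e - d)]

theorem activeValue_of_ge {d e : ℝ} (hd : 0 ≤ d) (hde : d ≤ e) (he : 3 / 5 ≤ e) (he1 : e ≤ 1) :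
    639 / 1000 ≤ activeValue d e := by
  rcases le_total d (3 / 5) with h | h
  · have hA : activeValue d e = activeValue d (3 / 5)
        + (e - 3 / 5) * (1197 / 2500 * d - 1303 / 6250) + 1303 / 5000 * (e - 3 / 5) ^ 2 := by
      simp only [activeValue, shareInt_of_ge he, shareInt_of_ge le_rfl, shareMoment_of_ge he,
        shareMoment_of_ge le_rfl]
      ring
    obtain ⟨s, rfl⟩ : ∃ s, d = 3 / 5 - s := ⟨3 / 5 - d, by ring⟩
    obtain ⟨r, rfl⟩ : ∃ r, e = r + 3 / 5 := ⟨e - 3 / 5, by ring⟩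
    have hs0 : 0 ≤ s := by linarith
    have hr0 : 0 ≤ r := by linarith
    have hB : activeValue (3 / 5 - s) (3 / 5) = 64384 / 100000 - 197 / 2500 * s
        + s ^ 2 * (1169 / 2500 - 111 / 1000 * s + 3 / 100 * s ^ 2 + 3 / 200 * s ^ 3) := by
      rw [activeValue, shareInt_of_le le_rfl, shareInt_of_le h, shareMoment_of_le le_rfl,
        shareMoment_of_le h]
      ring
    have hK : 2 / 5 ≤ 1169 / 2500 - 111 / 1000 * s + 3 / 100 * s ^ 2 + 3 / 200 * s ^ 3 := by
      have : 0 ≤ s ^ 3 := by positivity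
      nlinarith
    have hm := mul_le_mul_of_nonneg_left hK (sq_nonneg s)
    rw [hA, hB]
    nlinarith [sq_nonneg (s - 6 / 10 * r), sq_nonneg (s - 1 / 10), mul_nonneg hs0 hr0]
  · simp only [activeValue, shareInt_of_ge he, shareInt_of_ge h, shareMoment_of_ge he,
      shareMoment_of_ge h]
    nlinarith [mul_nonneg (sub_nonneg.2 hde) (sub_nonneg.2 he1),
      mul_nonneg (sub_nonneg.2 h) (sub_nonneg.2 he1), sq_nonneg (e - d)]

end Share

/-! ### Riemann sums of the sharing function. -/

section Sums

/-- `share` is the derivative of `shareInt` and has Lipschitz constant below 1, so the remainder is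
of second order. The cases come from the kink at 3/5. -/
theorem abs_shareInt_sub_le {x y : ℝ} (hx : 0 ≤ x) (hxy : x ≤ y) (hy : y ≤ 1) :
    |shareInt y - shareInt x - share x * (y - x)| ≤ (y - x) ^ 2 := by
  obtain ⟨z, rfl⟩ : ∃ z, y = x + z := ⟨y - x, by ring⟩
  have hz : 0 ≤ z := by linarith
  rw [abs_le]
  rcases le_total (x + z) (3 / 5) with h | h
  · have hx' : x ≤ 3 / 5 := by linarith
    rw [shareInt_of_le h, shareInt_of_le hx', share_of_le hx']
    have e : 9 / 25 * (x + z) + 9 / 200 * (x + z) ^ 2 + 3 / 40 * (x + z) ^ 4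
        - (9 / 25 * x + 9 / 200 * x ^ 2 + 3 / 40 * x ^ 4)
        - (9 / 25 + 9 / 100 * x + 3 / 10 * x ^ 3) * (x + z - x)
        = z ^ 2 * (9 / 200 + 3 / 40 * (6 * x ^ 2 + 4 * x * z + z ^ 2)) := by ring
    rw [e, add_sub_cancel_left]
    have h1 : 0 ≤ 9 / 200 + 3 / 40 * (6 * x ^ 2 + 4 * x * z + z ^ 2) := by positivity
    have h2 : 9 / 200 + 3 / 40 * (6 * x ^ 2 + 4 * x * z + z ^ 2) ≤ 1 := by nlinarith
    constructor <;> nlinarith [sq_nonneg z]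
  · rcases le_total x (3 / 5) with hx' | hx'
    · rw [shareInt_of_ge h, shareInt_of_le hx', share_of_le hx']
      obtain ⟨s, rfl⟩ : ∃ s, x = 3 / 5 - s := ⟨3 / 5 - x, by ring⟩
      have hs : 0 ≤ s := by linarith
      have hsz : 0 ≤ z - s := by linarith
      constructor
      · nlinarith [mul_nonneg hs hsz, mul_nonneg hs hx, mul_nonneg (mul_nonneg hs hsz) hx,
          mul_nonneg (mul_nonneg hs hs) hx, mul_nonneg (mul_nonneg (mul_nonneg hs hs) hx) hx,
          mul_nonneg (mul_nonneg (mul_nonneg hs hsz) hx) hx, pow_nonneg hs 4]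
      · nlinarith [mul_nonneg hs hsz, mul_nonneg hs hx, mul_nonneg (mul_nonneg hs hsz) hx,
          mul_nonneg (mul_nonneg hs hs) hx, mul_nonneg (mul_nonneg (mul_nonneg hs hs) hx) hx,
          mul_nonneg (mul_nonneg (mul_nonneg hs hsz) hx) hx, pow_nonneg hs 4]
    · rw [shareInt_of_ge h, shareInt_of_ge hx', share_of_ge hx']
      constructor <;> nlinarith [sq_nonneg z]

theorem abs_shareMoment_sub_le {x y : ℝ} (hx : 0 ≤ x) (hxy : x ≤ y) :
    |shareMoment y - shareMoment x - x * share x * (y - x)| ≤ (y - x) ^ 2 := by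
  have low : ∀ {x y : ℝ}, 0 ≤ x → x ≤ y → y ≤ 3 / 5 →
      0 ≤ shareMoment y - shareMoment x - x * share x * (y - x) ∧
      shareMoment y - shareMoment x - x * share x * (y - x) ≤ (y - x) ^ 2 / 2 := by
    intro x y hx hxy hy
    obtain ⟨z, rfl⟩ : ∃ z, y = x + z := ⟨y - x, by ring⟩
    have hz : 0 ≤ z := by linarith
    have hx' : x ≤ 3 / 5 := by linarith
    rw [shareMoment_of_le hy, shareMoment_of_le hx', share_of_le hx']
    have e : 9 / 50 * (x + z) ^ 2 + 3 / 100 * (x + z) ^ 3 + 3 / 50 * (x + z) ^ 5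
        - (9 / 50 * x ^ 2 + 3 / 100 * x ^ 3 + 3 / 50 * x ^ 5)
        - x * (9 / 25 + 9 / 100 * x + 3 / 10 * x ^ 3) * (x + z - x)
        = z ^ 2 * (9 / 50 + 3 / 100 * (3 * x + z)
          + 3 / 50 * (10 * x ^ 3 + 10 * x ^ 2 * z + 5 * x * z ^ 2 + z ^ 3)) := by ring
    rw [e, add_sub_cancel_left]
    have h2 : 9 / 50 + 3 / 100 * (3 * x + z)
        + 3 / 50 * (10 * x ^ 3 + 10 * x ^ 2 * z + 5 * x * z ^ 2 + z ^ 3) ≤ 1 / 2 := by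
      have h3 := pow_le_pow_left₀ (by linarith : 0 ≤ x + z) hy 3
      have h4 : x ^ 3 + x ^ 2 * z ≤ (3 / 5) ^ 2 * (3 / 5) := by
        calc x ^ 3 + x ^ 2 * z = x ^ 2 * (x + z) := by ring
          _ ≤ _ := mul_le_mul (pow_le_pow_left₀ hx hx' 2) hy (by linarith) (by norm_num)
      have h5 : 0 ≤ x ^ 3 := by positivity
      have h6 : 0 ≤ x ^ 2 * z := by positivity
      have h7 : 0 ≤ x * z ^ 2 := by positivity
      nlinarith
    exact ⟨by positivity, by nlinarith [sq_nonneg z]⟩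
  have high : ∀ {x y : ℝ}, 3 / 5 ≤ x → x ≤ y →
      shareMoment y - shareMoment x - x * share x * (y - x) = 1197 / 5000 * (y - x) ^ 2 := by
    intro x y hx hxy
    rw [shareMoment_of_ge (hx.trans hxy), shareMoment_of_ge hx, share_of_ge hx]
    ring
  rcases le_total y (3 / 5) with h | h
  · obtain ⟨h1, h2⟩ := low hx hxy h
    rw [abs_of_nonneg h1]
    linarith [sq_nonneg (y - x)]
  · rcases le_total x (3 / 5) with hx' | hx'
    · obtain ⟨h1, h2⟩ := low hx hx' le_rfl
      have h3 := high le_rfl h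
      have h4 : 0 ≤ 3 / 5 * share (3 / 5) - x * share x ∧
          3 / 5 * share (3 / 5) - x * share x ≤ 3 / 5 - x := by
        rw [share_of_ge le_rfl, share_of_le hx']
        constructor
        · nlinarith [pow_le_pow_left₀ hx hx' 4, mul_nonneg hx (sub_nonneg.2 hx')]
        · nlinarith [pow_nonneg hx 4, mul_nonneg hx (sub_nonneg.2 hx'),
            mul_nonneg (mul_nonneg hx hx) (sub_nonneg.2 hx'),
            mul_nonneg (mul_nonneg (mul_nonneg hx hx) hx) (sub_nonneg.2 hx')]
      -- Across the kink, the remainder is the sum of those on the two pieces and of a cross term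
      -- that is at most the product of their lengths.
      have e : shareMoment y - shareMoment x - x * share x * (y - x)
          = (shareMoment (3 / 5) - shareMoment x - x * share x * (3 / 5 - x))
          + (shareMoment y - shareMoment (3 / 5) - 3 / 5 * share (3 / 5) * (y - 3 / 5))
          + (3 / 5 * share (3 / 5) - x * share x) * (y - 3 / 5) := by ring
      rw [e, h3]
      have h5 := mul_nonneg h4.1 (sub_nonneg.2 h)
      have h6 := mul_le_mul_of_nonneg_right h4.2 (sub_nonneg.2 h)
      rw [abs_of_nonneg (by positivity)]
      nlinarith [sq_nonneg (3 / 5 - x), sq_nonneg (y - 3 / 5)]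
    · rw [high hx' hxy, abs_of_nonneg (by positivity)]
      nlinarith [sq_nonneg (y - x)]

/-- The sum that approximates `N * shareInt (k / N)`. -/
noncomputable def shareSum (N k : ℕ) : ℝ := ∑ i ∈ Finset.range k, share (i / N)

/-- The sum that approximates `N ^ 2 * shareMoment (k / N)`. -/
noncomputable def momentSum (N k : ℕ) : ℝ := ∑ i ∈ Finset.range k, i * share (i / N)

/-- A left Riemann sum of `F` approximates its antiderivative `Φ`. -/
theorem abs_riemann_sum_sub_le {F Φ : ℝ → ℝ} (h0 : Φ 0 = 0)
    (h : ∀ x y, 0 ≤ x → x ≤ y → y ≤ 1 → |Φ y - Φ x - F x * (y - x)| ≤ (y - x) ^ 2)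
    {N k : ℕ} (hN : 0 < N) (hk : k ≤ N) :
    |∑ i ∈ Finset.range k, F (i / N) - N * Φ (k / N)| ≤ 1 := by
  have hN' : (0 : ℝ) < N := by exact_mod_cast hN
  suffices |∑ i ∈ Finset.range k, F (i / N) - N * Φ (k / N)| ≤ k / N by
    refine this.trans ?_
    rw [div_le_one hN']
    exact_mod_cast hk
  induction k with
  | zero => simp [h0]
  | succ k ih =>
    have h1 := ih (by omega)
    have hk1 : ((k + 1 : ℕ) : ℝ) / N ≤ 1 := by
      rw [div_le_one hN']
      exact_mod_cast hk
    have h2 := h (k / N) ((k + 1 : ℕ) / N) (by positivity) (by gcongr; simp) hk1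
    have e : ((k + 1 : ℕ) : ℝ) / N - k / N = 1 / N := by push_cast; ring
    rw [e] at h2
    rw [Finset.sum_range_succ]
    have h3 : |N * (Φ ((k + 1 : ℕ) / N) - Φ (k / N) - F (k / N) * (1 / N))| ≤ 1 / N := by
      rw [abs_mul, abs_of_pos hN']
      calc _ ≤ N * (1 / (N : ℝ)) ^ 2 := mul_le_mul_of_nonneg_left h2 hN'.le
        _ = 1 / N := by field_simp
    have e2 : N * (Φ ((k + 1 : ℕ) / N) - Φ (k / N) - F (k / N) * (1 / N))
        = N * Φ ((k + 1 : ℕ) / N) - N * Φ (k / N) - F (k / N) := by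
      field_simp
    rw [e2] at h3
    have e3 : ((k + 1 : ℕ) : ℝ) / N = k / N + 1 / N := by push_cast; ring
    have h5 := abs_le.1 h1
    have h6 := abs_le.1 h3
    rw [abs_le]
    constructor <;> linarith

theorem abs_shareSum_sub_le {N k : ℕ} (hN : 0 < N) (hk : k ≤ N) :
    |shareSum N k - N * shareInt (k / N)| ≤ 1 :=
  abs_riemann_sum_sub_le (by rw [shareInt_of_le (by norm_num)]; norm_num)
    (fun _ _ => abs_shareInt_sub_le) hN hk

theorem abs_momentSum_sub_le {N k : ℕ} (hN : 0 < N) (hk : k ≤ N) :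
    |momentSum N k - N ^ 2 * shareMoment (k / N)| ≤ N := by
  have hN' : (0 : ℝ) < N := by exact_mod_cast hN
  have h := abs_riemann_sum_sub_le (F := fun x => x * share x) (Φ := shareMoment)
    (by rw [shareMoment_of_le (by norm_num)]; norm_num) (fun _ _ hx hxy _ => abs_shareMoment_sub_le hx hxy) hN hk
  have e : momentSum N k - N ^ 2 * shareMoment (k / N)
      = N * (∑ i ∈ Finset.range k, (i / N : ℝ) * share (i / N) - N * shareMoment (k / N)) := by
    rw [mul_sub, Finset.mul_sum, momentSum]
    congr 1
    · refine Finset.sum_congr rfl fun i _ => ?_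
      field_simp
    · ring
  rw [e, abs_mul, abs_of_pos hN']
  exact mul_le_of_le_one_right hN'.le h

end Sums

/-! ### Averaging the gain of an edge over the two times of its ends. -/

section PairSum

/-- The guaranteed share of a vertex processed at time `x / N`, when it is matched as an active
vertex up to the threshold `D` and, if `p` holds, as a passive one later on. -/
noncomputable def guarantee (N D : ℕ) (p : Prop) [Decidable p] (x : ℕ) : ℝ :=
  if x < D then share (x / N) else if p then 1 - share (D / N) else 0

theorem guarantee_nonneg (N D : ℕ) (p : Prop) [Decidable p] (x : ℕ) : 0 ≤ guarantee N D p x := by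
  unfold guarantee
  have h1 := le_share (x := x / N) (by positivity)
  have h2 := share_le (x := D / N) (by positivity)
  split_ifs <;> linarith

theorem sum_guarantee {N D : ℕ} (hD : D ≤ N) (p : Prop) [Decidable p] :
    ∑ x ∈ Finset.range N, guarantee N D p x
      = shareSum N D + (N - D) * (if p then 1 - share (D / N) else 0) := by
  rw [← Finset.sum_range_add_sum_Ico _ hD]
  congr 1
  · exact Finset.sum_congr rfl fun x hx => by simp [guarantee, Finset.mem_range.1 hx]
  · rw [Finset.sum_congr rfl (g := fun _ => if p then 1 - share (D / N) else 0)
      fun x hx => by simp [guarantee, (Finset.mem_Ico.1 hx).1]]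
    rw [Finset.sum_const, Nat.card_Ico, nsmul_eq_mul, Nat.cast_sub hD]

theorem sum_Ico_sub (D E : ℕ) (h : D ≤ E) (w : ℕ → ℝ) :
    ∑ y ∈ Finset.Ico D E, ((y : ℝ) - D) * w y
      = (∑ y ∈ Finset.range E, y * w y - ∑ y ∈ Finset.range D, y * w y)
        - D * (∑ y ∈ Finset.range E, w y - ∑ y ∈ Finset.range D, w y) := by
  rw [← Finset.sum_Ico_eq_sub _ h, ← Finset.sum_Ico_eq_sub _ h, Finset.mul_sum,
    ← Finset.sum_sub_distrib]
  exact Finset.sum_congr rfl fun y _ => by ring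

theorem sum_Ico_sub_one (D E : ℕ) (h : D ≤ E) :
    ∑ y ∈ Finset.Ico D E, ((y : ℝ) - D) = ((E : ℝ) - D) * (E - D - 1) / 2 := by
  induction E, h using Nat.le_induction with
  | base => simp
  | succ E h ih =>
    rw [Finset.sum_Ico_succ_top h, ih]
    push_cast
    ring

/-- The number of `x` in `[D, M)` below `y`. -/
theorem sum_ite_between {N D M : ℕ} (hM : M ≤ N) (y : ℕ) (w : ℝ) :
    ∑ x ∈ Finset.range N, (if D ≤ x ∧ x < M ∧ x < y then w else 0) = ((min M y - D : ℕ) : ℝ) * w := by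
  rw [← Finset.sum_filter, Finset.sum_const, nsmul_eq_mul]
  congr 2
  rw [← Nat.card_Ico]
  congr 1
  ext x
  simp only [Finset.mem_filter, Finset.mem_range, Finset.mem_Ico]
  omega

/-- The truncated subtraction counts the x in [D, E) below y: none for y < D, and all of them for y
≥ E. -/
theorem sum_range_min_sub {N D E : ℕ} (hD : D ≤ E) (hE : E ≤ N) (w : ℕ → ℝ) :
    ∑ y ∈ Finset.range N, ((min E y - D : ℕ) : ℝ) * w y
      = ∑ y ∈ Finset.Ico D E, ((y : ℝ) - D) * w y + (E - D) * ∑ y ∈ Finset.Ico E N, w y := by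
  rw [← Finset.sum_range_add_sum_Ico _ hE, ← Finset.sum_range_add_sum_Ico _ hD]
  rw [Finset.sum_eq_zero (s := Finset.range D)]
  · rw [zero_add, Finset.mul_sum]
    congr 1
    · refine Finset.sum_congr rfl fun y hy => ?_
      rw [Finset.mem_Ico] at hy
      rw [min_eq_right hy.2.le, Nat.cast_sub hy.1]
    · refine Finset.sum_congr rfl fun y hy => ?_
      rw [Finset.mem_Ico] at hy
      rw [min_eq_left hy.1, Nat.cast_sub hD]
  · intro y hy
    rw [Finset.mem_range] at hy
    rw [Nat.sub_eq_zero_of_le (by omega)]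
    simp

theorem sum_range_sub {N D : ℕ} (hD : D ≤ N) (w : ℕ → ℝ) :
    ∑ y ∈ Finset.range N, ((min N y - D : ℕ) : ℝ) * w y
      = ∑ y ∈ Finset.Ico D N, ((y : ℝ) - D) * w y := by
  rw [sum_range_min_sub hD le_rfl]
  simp

variable {N D E : ℕ} {g : ℕ → ℕ → ℝ}

/-- A lower bound for a double sum, in terms of guaranteed shares and of the cells in which a whole
unit is gained. -/
theorem sum_le_of_guarantee {p q : Prop} [Decidable p] [Decidable q] (hD : D ≤ N) (hE : E ≤ N)
    {r : ℕ → ℕ → ℝ} (h : ∀ x < N, ∀ y < N, guarantee N D p x + guarantee N E q y + r x y ≤ g x y) :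
    N * (shareSum N D + (N - D) * (if p then 1 - share (D / N) else 0))
      + N * (shareSum N E + (N - E) * (if q then 1 - share (E / N) else 0))
      + ∑ x ∈ Finset.range N, ∑ y ∈ Finset.range N, r x y
      ≤ ∑ x ∈ Finset.range N, ∑ y ∈ Finset.range N, g x y := by
  have := Finset.sum_le_sum fun x (hx : x ∈ Finset.range N) =>
    Finset.sum_le_sum fun y (hy : y ∈ Finset.range N) =>
      h x (Finset.mem_range.1 hx) y (Finset.mem_range.1 hy)
  refine le_trans (le_of_eq ?_) this
  simp only [Finset.sum_add_distrib, Finset.sum_const, Finset.card_range, nsmul_eq_mul,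
    sum_guarantee hD, sum_guarantee hE, ← Finset.mul_sum]
  ring

/-- The error 5N covers 2N from the moment sums, 2N from the share sums multiplied by D ≤ N, and (E
- D)/2 from the triangular number. -/
theorem sum_one_sub_share_bound (hN : 0 < N) (hDE : D ≤ E) (hE : E ≤ N) :
    N ^ 2 * (((E / N - D / N) ^ 2 / 2 : ℝ) - (shareMoment (E / N) - shareMoment (D / N)
      - D / N * (shareInt (E / N) - shareInt (D / N)))) - 5 * N
      ≤ ∑ y ∈ Finset.Ico D E, ((y : ℝ) - D) * (1 - share (y / N)) := by
  have hN' : (0 : ℝ) < N := by exact_mod_cast hN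
  rw [Finset.sum_congr rfl fun (y : ℕ) _ => mul_one_sub ((y : ℝ) - D) (share (y / N)),
    Finset.sum_sub_distrib, sum_Ico_sub_one D E hDE, sum_Ico_sub D E hDE]
  have a1 := abs_le.1 (abs_shareSum_sub_le hN hE)
  have a2 := abs_le.1 (abs_shareSum_sub_le hN (hDE.trans hE))
  have a3 := abs_le.1 (abs_momentSum_sub_le hN hE)
  have a4 := abs_le.1 (abs_momentSum_sub_le hN (hDE.trans hE))
  change _ ≤ _ - ((momentSum N E - momentSum N D) - D * (shareSum N E - shareSum N D))
  have hD0 : (0 : ℝ) ≤ D := Nat.cast_nonneg D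
  have hDN : (D : ℝ) ≤ N := by exact_mod_cast hDE.trans hE
  have hEN : (E : ℝ) ≤ N := by exact_mod_cast hE
  have b1 := mul_le_mul_of_nonneg_left a1.1 hD0
  have b2 := mul_le_mul_of_nonneg_left a2.2 hD0
  have e1 : (N : ℝ) ^ 2 * ((E / N - D / N) ^ 2 / 2) = (E - D) ^ 2 / 2 := by field_simp
  have e2 : (N : ℝ) ^ 2 * (D / N * shareInt (E / N)) = D * (N * shareInt (E / N)) := by field_simp
  have e3 : (N : ℝ) ^ 2 * (D / N * shareInt (D / N)) = D * (N * shareInt (D / N)) := by field_simp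
  have e4 : (N : ℝ) ^ 2 * (((E / N - D / N) ^ 2 / 2 : ℝ) - (shareMoment (E / N) - shareMoment (D / N)
      - D / N * (shareInt (E / N) - shareInt (D / N)))) = N ^ 2 * ((E / N - D / N) ^ 2 / 2)
      - (N ^ 2 * shareMoment (E / N) - N ^ 2 * shareMoment (D / N)
      - (N ^ 2 * (D / N * shareInt (E / N)) - N ^ 2 * (D / N * shareInt (D / N)))) := by ring
  rw [e4, e1, e2, e3]
  nlinarith

/-- In the cells with D ≤ x < E and x < y the first end has no guarantee, so the whole unit there
adds one minus the guarantee of the second end. Summing these bonuses turns the total into N² times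
`mixedValue`, up to 7N. -/
theorem sum_ge_of_mixed (hN : 0 < N) (hDE : D ≤ E) (hE : E ≤ N)
    (h0 : ∀ x < N, ∀ y < N, guarantee N D False x + guarantee N E True y ≤ g x y)
    (h1 : ∀ x < N, ∀ y < N, x < y → D ≤ x → x < E → 1 ≤ g x y) :
    639 / 1000 * (N : ℝ) ^ 2 - 7 * N ≤ ∑ x ∈ Finset.range N, ∑ y ∈ Finset.range N, g x y := by
  have hN' : (0 : ℝ) < N := by exact_mod_cast hN
  have hs := sum_le_of_guarantee (p := False) (q := True) (hDE.trans hE) hE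
    (r := fun x y => if D ≤ x ∧ x < E ∧ x < y then 1 - guarantee N E True y else 0) (g := g) (by
      intro x hx y hy
      split_ifs with h
      · have : guarantee N D False x = 0 := by simp [guarantee, h.1]
        rw [this]
        linarith [h1 x hx y hy h.2.2 h.1 h.2.1]
      · linarith [h0 x hx y hy])
  refine le_trans ?_ hs
  rw [Finset.sum_comm, Finset.sum_congr rfl fun y _ => sum_ite_between hE y _,
    sum_range_min_sub hDE hE,
    Finset.sum_congr (s₁ := Finset.Ico D E) rfl (g := fun y => ((y : ℝ) - D) * (1 - share (y / N)))
      (fun y hy => by simp [guarantee, (Finset.mem_Ico.1 hy).2]),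
    Finset.sum_congr (s₁ := Finset.Ico E N) rfl (g := fun y => share (E / N))
      (fun y hy => by simp [guarantee, (Finset.mem_Ico.1 hy).1.not_gt]),
    Finset.sum_const, Nat.card_Ico, nsmul_eq_mul, Nat.cast_sub hE]
  have hb := sum_one_sub_share_bound hN hDE hE
  have hv : (639 / 1000 : ℝ) ≤ mixedValue (D / N) (E / N) := by
    have hde : (D / N : ℝ) ≤ E / N := by gcongr
    have he1 : (E / N : ℝ) ≤ 1 := by
      rw [div_le_one hN']
      exact_mod_cast hE
    rcases le_total (E / N : ℝ) (3 / 5) with h | h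
    · exact mixedValue_of_le (by positivity) hde h
    · exact mixedValue_of_ge (by positivity) hde h he1
  have a1 := abs_le.1 (abs_shareSum_sub_le hN hE)
  have a2 := abs_le.1 (abs_shareSum_sub_le hN (hDE.trans hE))
  have hv' := mul_le_mul_of_nonneg_left hv (sq_nonneg (N : ℝ))
  have c1 := mul_le_mul_of_nonneg_left a1.1 hN'.le
  have c2 := mul_le_mul_of_nonneg_left a2.1 hN'.le
  have e : (N : ℝ) ^ 2 * mixedValue (D / N) (E / N) = N * (N * shareInt (D / N))
      + N * (N * shareInt (E / N)) + N * ((N - E) * (1 - share (E / N)))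
      + N ^ 2 * (((E / N - D / N) ^ 2 / 2 : ℝ) - (shareMoment (E / N) - shareMoment (D / N)
      - D / N * (shareInt (E / N) - shareInt (D / N))))
      + (E - D) * ((N - E) * share (E / N)) := by
    unfold mixedValue
    field_simp
    ring
  rw [e] at hv'
  simp only [if_true, if_false, mul_zero, add_zero]
  linarith

/-- There are two disjoint bonus regions: x < y with D ≤ x, and y < x with E ≤ y. In the second one,
D ≤ E makes both guarantees vanish, so the bonus is a full unit. -/
theorem sum_ge_of_active (hN : 0 < N) (hDE : D ≤ E) (hE : E ≤ N)
    (h0 : ∀ x < N, ∀ y < N, guarantee N D False x + guarantee N E False y ≤ g x y)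
    (h1 : ∀ x < N, ∀ y < N, x < y → D ≤ x → 1 ≤ g x y)
    (h2 : ∀ x < N, ∀ y < N, y < x → E ≤ y → 1 ≤ g x y) :
    639 / 1000 * (N : ℝ) ^ 2 - 8 * N ≤ ∑ x ∈ Finset.range N, ∑ y ∈ Finset.range N, g x y := by
  have hN' : (0 : ℝ) < N := by exact_mod_cast hN
  have hs := sum_le_of_guarantee (p := False) (q := False) (hDE.trans hE) hE
    (r := fun x y => (if D ≤ x ∧ x < N ∧ x < y then 1 - guarantee N E False y else 0)
      + if E ≤ y ∧ y < N ∧ y < x then 1 else 0) (g := g) (by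
      intro x hx y hy
      split_ifs with h h' h'
      · omega
      · have : guarantee N D False x = 0 := by simp [guarantee, h.1]
        rw [this]
        linarith [h1 x hx y hy h.2.2 h.1]
      · have e1 : guarantee N D False x = 0 := by
          simp [guarantee, hDE.trans (h'.1.trans h'.2.2.le)]
        have e2 : guarantee N E False y = 0 := by simp [guarantee, h'.1]
        rw [e1, e2]
        linarith [h2 x hx y hy h'.2.2 h'.1]
      · linarith [h0 x hx y hy])
  refine le_trans ?_ hs
  have r1 : ∑ x ∈ Finset.range N, ∑ y ∈ Finset.range N,
      (if D ≤ x ∧ x < N ∧ x < y then 1 - guarantee N E False y else 0)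
      = ∑ y ∈ Finset.Ico D E, ((y : ℝ) - D) * (1 - share (y / N))
        + ∑ y ∈ Finset.Ico E N, ((y : ℝ) - D) := by
    rw [Finset.sum_comm, Finset.sum_congr rfl fun y _ => sum_ite_between le_rfl y _,
      sum_range_sub (hDE.trans hE), ← Finset.sum_Ico_consecutive _ hDE hE,
      Finset.sum_congr (s₁ := Finset.Ico D E) rfl (g := fun y => ((y : ℝ) - D) * (1 - share (y / N)))
        (fun y hy => by simp [guarantee, (Finset.mem_Ico.1 hy).2]),
      Finset.sum_congr (s₁ := Finset.Ico E N) rfl (g := fun y => ((y : ℝ) - D))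
        (fun y hy => by simp [guarantee, (Finset.mem_Ico.1 hy).1.not_gt])]
  have r2 : ∑ x ∈ Finset.range N, ∑ y ∈ Finset.range N,
      (if E ≤ y ∧ y < N ∧ y < x then (1 : ℝ) else 0) = ((N : ℝ) - E) * (N - E - 1) / 2 := by
    rw [Finset.sum_congr rfl fun x _ => sum_ite_between le_rfl x _, sum_range_sub hE]
    simp only [mul_one]
    exact sum_Ico_sub_one E N hE
  have r3 : ∑ y ∈ Finset.Ico E N, ((y : ℝ) - D)
      = ((N : ℝ) - D) * (N - D - 1) / 2 - (E - D) * (E - D - 1) / 2 := by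
    rw [← sum_Ico_sub_one D N (hDE.trans hE), ← sum_Ico_sub_one D E hDE,
      ← Finset.sum_Ico_consecutive _ hDE hE]
    ring
  simp only [Finset.sum_add_distrib]
  rw [r1, r2, r3]
  have hb := sum_one_sub_share_bound hN hDE hE
  have hv : (639 / 1000 : ℝ) ≤ activeValue (D / N) (E / N) := by
    have hde : (D / N : ℝ) ≤ E / N := by gcongr
    have he1 : (E / N : ℝ) ≤ 1 := by
      rw [div_le_one hN']
      exact_mod_cast hE
    rcases le_total (E / N : ℝ) (3 / 5) with h | h
    · exact activeValue_of_le (by positivity) hde h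
    · exact activeValue_of_ge (by positivity) hde h he1
  have a1 := abs_le.1 (abs_shareSum_sub_le hN hE)
  have a2 := abs_le.1 (abs_shareSum_sub_le hN (hDE.trans hE))
  have hv' := mul_le_mul_of_nonneg_left hv (sq_nonneg (N : ℝ))
  have c1 := mul_le_mul_of_nonneg_left a1.1 hN'.le
  have c2 := mul_le_mul_of_nonneg_left a2.1 hN'.le
  have e : (N : ℝ) ^ 2 * activeValue (D / N) (E / N) = N * (N * shareInt (D / N))
      + N * (N * shareInt (E / N)) + (N - D) * (N - E)
      + N ^ 2 * (((E / N - D / N) ^ 2 / 2 : ℝ) - (shareMoment (E / N) - shareMoment (D / N)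
      - D / N * (shareInt (E / N) - shareInt (D / N)))) := by
    unfold activeValue
    field_simp
    ring
  rw [e] at hv'
  simp only [if_false, mul_zero, add_zero]
  have hD0 : (0 : ℝ) ≤ D := Nat.cast_nonneg D
  have hE0 : (0 : ℝ) ≤ E := Nat.cast_nonneg E
  nlinarith

/-- The average gain of a pair of vertices, over the times at which they are processed. -/
theorem sum_ge_of_thresholds {p q : Prop} [Decidable p] [Decidable q] (hN : 0 < N) (hD : D ≤ N)
    (hE : E ≤ N)
    (h0 : ∀ x < N, ∀ y < N, guarantee N D p x + guarantee N E q y ≤ g x y)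
    (h1 : ∀ x < N, ∀ y < N, x < y → D ≤ x → ¬ p → x + 1 < E ∨ ¬ q → 1 ≤ g x y)
    (h2 : ∀ x < N, ∀ y < N, y < x → E ≤ y → ¬ q → y + 1 < D ∨ ¬ p → 1 ≤ g x y) :
    639 / 1000 * (N : ℝ) ^ 2 - 8 * N ≤ ∑ x ∈ Finset.range N, ∑ y ∈ Finset.range N, g x y := by
  have hN' : (0 : ℝ) < N := by exact_mod_cast hN
  have g0 : ∀ x < N, ∀ y < N, 0 ≤ g x y := fun x hx y hy =>
    (add_nonneg (guarantee_nonneg N D p x) (guarantee_nonneg N E q y)).trans (h0 x hx y hy)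
  have shrink : ∀ D E, E ≤ D → ∀ x, guarantee N E False x ≤ guarantee N D False x := by
    intro D E h x
    have := le_share (x := x / N) (by positivity)
    by_cases h1 : x < E
    · simp [guarantee, h1, h1.trans_le h]
    · simpa [guarantee, h1] using guarantee_nonneg N D False x
  have mixed : ∀ {D E : ℕ} {g : ℕ → ℕ → ℝ}, D ≤ N → E ≤ N → (∀ x < N, ∀ y < N, 0 ≤ g x y) →
      (∀ x < N, ∀ y < N, guarantee N D False x + guarantee N E True y ≤ g x y) →
      (∀ x < N, ∀ y < N, x < y → D ≤ x → x + 1 < E → 1 ≤ g x y) →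
      639 / 1000 * (N : ℝ) ^ 2 - 8 * N ≤ ∑ x ∈ Finset.range N, ∑ y ∈ Finset.range N, g x y := by
    intro D E g hD hE g0 h0 h1
    -- In the row x = E - 1 ties may spoil the unit gain. That row is topped up by 1, at a total
    -- cost of at most N.
    have key : 639 / 1000 * (N : ℝ) ^ 2 - 7 * N
        ≤ ∑ x ∈ Finset.range N, ∑ y ∈ Finset.range N, (g x y + if x + 1 = E then 1 else 0) := by
      have hi : ∀ x : ℕ, (0 : ℝ) ≤ if x + 1 = E then 1 else 0 := fun x => by split_ifs <;> norm_num
      -- If E < D, the first threshold is lowered to E: this only weakens the guarantee and leaves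
      -- no bonus cell.
      refine sum_ge_of_mixed (D := min D E) hN (min_le_right _ _) hE ?_ ?_
      · intro x hx y hy
        linarith [h0 x hx y hy, shrink D (min D E) (min_le_left _ _) x, hi x]
      · intro x hx y hy hxy hDx hxE
        by_cases h : x + 1 = E
        · rw [if_pos h]
          linarith [g0 x hx y hy]
        · rw [if_neg h, add_zero]
          exact h1 x hx y hy hxy (by omega) (by omega)
    have e : ∑ x ∈ Finset.range N, ∑ y ∈ Finset.range N, (if x + 1 = E then (1 : ℝ) else 0) ≤ N := by
      rw [Finset.sum_comm]
      have : ∀ y ∈ Finset.range N, ∑ x ∈ Finset.range N, (if x + 1 = E then (1 : ℝ) else 0) ≤ 1 := by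
        intro y _
        rw [← Finset.sum_filter, Finset.sum_const, nsmul_eq_mul, mul_one]
        have : (Finset.filter (fun x => x + 1 = E) (Finset.range N)).card ≤ 1 :=
          Finset.card_le_one.2 fun a ha b hb => by
            simp only [Finset.mem_filter] at ha hb
            omega
        exact_mod_cast this
      simpa using Finset.sum_le_sum this
    simp only [Finset.sum_add_distrib] at key
    linarith
  by_cases hp : p <;> by_cases hq : q <;> simp only [hp, hq] at h0 h1 h2
  · have := sum_le_of_guarantee (p := True) (q := True) (r := fun _ _ => 0) hD hE
      (fun x hx y hy => by simpa using h0 x hx y hy)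
    refine le_trans ?_ this
    -- When both ends can be matched passively, each is guaranteed 9/25 on average, and 18/25 >
    -- 0.639.
    have half : ∀ {D : ℕ}, D ≤ N → 9 / 25 * (N : ℝ) ≤ shareSum N D + (N - D) * (1 - share (D / N)) := by
      intro D hD
      have h3 : (D : ℝ) * (9 / 25) ≤ shareSum N D := by
        have := Finset.card_nsmul_le_sum (Finset.range D) (fun i : ℕ => share (i / N)) (9 / 25)
          fun i _ => le_share (by positivity)
        simpa [shareSum] using this
      have h4 := share_le (x := D / N) (by positivity)
      have h5 : (0 : ℝ) ≤ N - D := sub_nonneg.2 (by exact_mod_cast hD)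
      nlinarith
    have := mul_le_mul_of_nonneg_left (half hD) hN'.le
    have := mul_le_mul_of_nonneg_left (half hE) hN'.le
    simp only [if_true, Finset.sum_const_zero, add_zero]
    nlinarith
  · rw [Finset.sum_comm]
    refine mixed (g := fun y x => g x y) hE hD (fun y hy x hx => g0 x hx y hy) ?_ ?_
    · intro y hy x hx
      linarith [h0 x hx y hy]
    · intro y hy x hx hyx hEy hyD
      exact h2 x hx y hy hyx hEy not_false (Or.inl hyD)
  · refine mixed hD hE g0 h0 ?_
    intro x hx y hy hxy hDx hxE
    exact h1 x hx y hy hxy hDx not_false (Or.inl hxE)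
  · rcases le_total D E with h | h
    · exact sum_ge_of_active hN h hE h0
        (fun x hx y hy hxy hDx => h1 x hx y hy hxy hDx not_false (Or.inr not_false))
        (fun x hx y hy hxy hEy => h2 x hx y hy hxy hEy not_false (Or.inr not_false))
    · rw [Finset.sum_comm]
      refine sum_ge_of_active (g := fun y x => g x y) hN h hD
        (fun y hy x hx => by linarith [h0 x hx y hy])
        (fun y hy x hx hxy hEy => h2 x hx y hy hxy hEy not_false (Or.inr not_false))
        (fun y hy x hx hxy hDx => h1 x hx y hy hxy hDx not_false (Or.inr not_false))

end PairSum

/-! ### Translation from probe sequences to the process on unmatched vertices. -/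

section Link

variable {V : Type*} [Fintype V] [DecidableEq V] (G : SimpleGraph V) [DecidableRel G.Adj]

/-- The vertices that are not covered by a set of edges. -/
def uncovered (M : Finset (Sym2 V)) : Finset V := Finset.univ.filter fun w => ∀ e ∈ M, w ∉ e

theorem mem_uncovered {M : Finset (Sym2 V)} {w : V} : w ∈ uncovered M ↔ ∀ e ∈ M, w ∉ e := by
  simp [uncovered]

theorem uncovered_insert (M : Finset (Sym2 V)) (u w : V) :
    uncovered (insert s(u, w) M) = ((uncovered M).erase u).erase w := by
  ext x
  simp only [mem_uncovered, Finset.mem_insert, forall_eq_or_imp, Sym2.mem_iff, Finset.mem_erase]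
  tauto

theorem probe_of_covered {M : Finset (Sym2 V)} {u : V} (hu : u ∉ uncovered M) (w : V) :
    probe G M (u, w) = M := by
  rw [probe, if_neg]
  rintro ⟨-, h⟩
  exact hu (mem_uncovered.2 fun e he => (h e he).1)

theorem foldl_probe_of_covered {M : Finset (Sym2 V)} {u : V} (hu : u ∉ uncovered M) (l : List V) :
    (l.map fun w => (u, w)).foldl (probe G) M = M := by
  induction l with
  | nil => rfl
  | cons w l ih => rw [List.map_cons, List.foldl_cons, probe_of_covered G hu, ih]

/-- Probes before the first available neighbour fail, and once one succeeds `u` is covered, so the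
remaining probes are idle. -/
theorem foldl_probe (pl : V → List V) (M : Finset (Sym2 V)) (u : V) :
    (((pl u).filter fun w => w ≠ u).map fun w => (u, w)).foldl (probe G) M =
      match choice G pl (uncovered M) u with
      | none => M
      | some w => insert s(u, w) M := by
  by_cases hu : u ∈ uncovered M
  · unfold choice
    rw [if_pos hu]
    generalize pl u = l
    induction l with
    | nil => rfl
    | cons w l ih =>
      rw [List.find?_cons]
      by_cases hw : G.Adj u w ∧ w ∈ uncovered M
      · rw [List.filter_cons_of_pos (by simpa using hw.1.ne'), List.map_cons, List.foldl_cons]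
        have e : probe G M (u, w) = insert s(u, w) M := by
          rw [probe, if_pos]
          exact ⟨hw.1, fun e he => ⟨mem_uncovered.1 hu e he, mem_uncovered.1 hw.2 e he⟩⟩
        rw [e, foldl_probe_of_covered]
        · simp [hw]
        · rw [uncovered_insert]
          simp
      · have e : probe G M (u, w) = M := by
          rw [probe, if_neg]
          rintro ⟨h1, h2⟩
          exact hw ⟨h1, mem_uncovered.2 fun e he => (h2 e he).2⟩
        simp only [hw, decide_false]
        rw [← ih]
        by_cases hwu : w = u
        · rw [List.filter_cons_of_neg (by simpa using hwu)]
        · rw [List.filter_cons_of_pos (by simpa using hwu), List.map_cons, List.foldl_cons, e]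
  · rw [foldl_probe_of_covered G hu, choice_of_notMem hu]

theorem card_foldl_probe (pl : V → List V) (M : Finset (Sym2 V)) (L : List V) :
    ((L.flatMap fun u => ((pl u).filter fun w => w ≠ u).map fun w => (u, w)).foldl
      (probe G) M).card = M.card + size G pl (uncovered M) L := by
  induction L generalizing M with
  | nil => simp [size]
  | cons u L ih =>
    rw [List.flatMap_cons, List.foldl_append, foldl_probe]
    rcases h : choice G pl (uncovered M) u with _ | w
    · simp only [size, h, ih]
    · simp only [size, h, ih, uncovered_insert]
      rw [Finset.card_insert_of_notMem]
      · ring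
      · intro hM
        exact mem_uncovered.1 (choice_eq_some h).1 _ hM (Sym2.mem_mk_left u w)

theorem card_rdoMatching (pref : V → VertexOrder V) (order : VertexOrder V) :
    (rdoMatching G pref order).card
      = size G (fun u => List.ofFn (pref u)) Finset.univ (List.ofFn order) := by
  have h := card_foldl_probe G (fun u => List.ofFn (pref u)) ∅ (List.ofFn order)
  have e : uncovered (∅ : Finset (Sym2 V)) = Finset.univ := by simp [uncovered]
  rw [Finset.card_empty, zero_add, e] at h
  exact h

end Link

/-! ### Thresholds of an edge when the times of all other vertices are fixed. -/

section Thresholds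

variable {V : Type*}

/-- The position of `w` in the decision order given by the times `t`, ties being broken by `idx`. -/
def key (idx : V → ℕ) (t : V → ℕ) (w : V) : ℕ ×ₗ ℕ := toLex (t w, idx w)

/-- The part of a list of vertices that precedes the position `k`. -/
def before (idx : V → ℕ) (t : V → ℕ) (O : List V) (k : ℕ ×ₗ ℕ) : List V :=
  O.filter fun w => decide (key idx t w < k)

variable {idx : V → ℕ} {t : V → ℕ}

theorem mem_before {O : List V} {k : ℕ ×ₗ ℕ} {w : V} :
    w ∈ before idx t O k ↔ w ∈ O ∧ key idx t w < k := by
  simp [before]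

theorem time_le_of_key_lt {w : V} {x i : ℕ} (h : key idx t w < toLex (x, i)) : t w ≤ x := by
  rw [key, Prod.Lex.toLex_lt_toLex] at h
  rcases h with h | h
  · exact h.le
  · exact h.1.le

theorem before_append {O : List V} (hO : O.Pairwise fun a b => key idx t a < key idx t b)
    (k : ℕ ×ₗ ℕ) : ∃ R, O = before idx t O k ++ R := by
  induction O with
  | nil => exact ⟨[], rfl⟩
  | cons w O ih =>
    rw [List.pairwise_cons] at hO
    by_cases h : key idx t w < k
    · obtain ⟨R, hR⟩ := ih hO.2
      refine ⟨R, ?_⟩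
      have : before idx t (w :: O) k = w :: before idx t O k :=
        List.filter_cons_of_pos (by simpa using h)
      rw [this, List.cons_append, ← hR]
    · refine ⟨w :: O, ?_⟩
      have : before idx t (w :: O) k = [] := by
        rw [before, List.filter_eq_nil_iff]
        intro z hz
        rcases List.mem_cons.1 hz with rfl | hz
        · simpa using h
        · simpa using (not_lt.1 h).trans (hO.1 z hz).le
      rw [this, List.nil_append]

theorem before_before {O : List V} {k k' : ℕ ×ₗ ℕ} (hk : k ≤ k') :
    before idx t (before idx t O k') k = before idx t O k := by
  rw [before, before, List.filter_filter, before]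
  refine List.filter_congr fun w _ => ?_
  rw [Bool.eq_iff_iff]
  simp only [Bool.and_eq_true, decide_eq_true_eq]
  exact ⟨fun h => h.1, fun h => ⟨h, h.trans_le hk⟩⟩

theorem before_key_eq {L₁ L₂ : List V} {u : V}
    (h : (L₁ ++ u :: L₂).Pairwise fun a b => key idx t a < key idx t b) :
    before idx t (L₁ ++ u :: L₂) (key idx t u) = L₁ := by
  rw [List.pairwise_append, List.pairwise_cons] at h
  rw [before, List.filter_append, List.filter_cons_of_neg (by simp)]
  have e1 : L₁.filter (fun w => decide (key idx t w < key idx t u)) = L₁ :=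
    List.filter_eq_self.2 fun w hw => by simpa using h.2.2 w hw u List.mem_cons_self
  have e2 : L₂.filter (fun w => decide (key idx t w < key idx t u)) = [] :=
    List.filter_eq_nil_iff.2 fun w hw => by simpa using (h.2.1.1 w hw).le
  rw [e1, e2, List.append_nil]

theorem eq_of_pairwise_key {O O' : List V} (hO : O.Pairwise fun a b => key idx t a < key idx t b)
    (hO' : O'.Pairwise fun a b => key idx t a < key idx t b) (h : ∀ w, w ∈ O ↔ w ∈ O') :
    O = O' := by
  have nd : ∀ {l : List V}, (l.Pairwise fun a b => key idx t a < key idx t b) → l.Nodup :=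
    fun hl => hl.imp fun {a b} hab => by rintro rfl; exact lt_irrefl _ hab
  refine List.Perm.eq_of_pairwise (fun a b _ _ h1 h2 => absurd h1 (lt_asymm h2)) hO hO' ?_
  exact (List.perm_ext_iff_of_nodup (nd hO) (nd hO')).2 h

theorem exists_threshold (N : ℕ) {P : ℕ → Prop} (hP : ∀ x y, x ≤ y → P y → P x) :
    ∃ D ≤ N, ∀ x < N, P x ↔ x < D := by
  classical
  induction N with
  | zero => exact ⟨0, le_rfl, fun x hx => by omega⟩
  | succ N ih =>
    by_cases h : P N
    · exact ⟨N + 1, le_rfl, fun x hx => ⟨fun _ => hx, fun _ => hP x N (by omega) h⟩⟩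
    · obtain ⟨D, hD, hx⟩ := ih
      refine ⟨D, hD.trans N.le_succ, fun x hxN => ?_⟩
      rcases Nat.lt_succ_iff_lt_or_eq.1 hxN with h1 | rfl
      · exact hx x h1
      · exact ⟨fun h1 => absurd h1 h, fun h1 => by omega⟩

/-- Up to the turn of `u`, and ignoring `v`, the full order agrees with the order `O` of the other
vertices. This makes the thresholds independent of the times of `u` and `v`. -/
theorem before_filter_ne [DecidableEq V] {O L : List V} {u v : V} {t' : V → ℕ}
    (hO : O.Pairwise fun a b => key idx t a < key idx t b)
    (hOm : ∀ w, w ∈ O ↔ w ≠ u ∧ w ≠ v) (ht : ∀ w, w ≠ u → w ≠ v → t' w = t w)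
    (hL : L.Pairwise fun a b => key idx t' a < key idx t' b) (hLm : ∀ w, w ∈ L) {k : ℕ ×ₗ ℕ}
    (hk : k ≤ key idx t' u) : (before idx t' L k).filter (· ≠ v) = before idx t O k := by
  have hkey : ∀ w, w ≠ u → w ≠ v → key idx t' w = key idx t w := fun w h1 h2 => by
    rw [key, key, ht w h1 h2]
  have hm : ∀ w, w ∈ (before idx t' L k).filter (· ≠ v) → w ≠ u ∧ w ≠ v := by
    intro w hw
    rw [List.mem_filter, mem_before] at hw
    refine ⟨?_, by simpa using hw.2⟩
    rintro rfl
    exact absurd hw.1.2 (not_lt.2 hk)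
  refine eq_of_pairwise_key (idx := idx) (t := t) ?_ (hO.filter _) fun w => ?_
  · refine ((hL.filter _).filter _).imp_of_mem fun {a b} ha hb hab => ?_
    rwa [hkey a (hm a ha).1 (hm a ha).2, hkey b (hm b hb).1 (hm b hb).2] at hab
  · rw [mem_before, hOm]
    constructor
    · intro hw
      refine ⟨hm w hw, ?_⟩
      rw [← hkey w (hm w hw).1 (hm w hw).2]
      rw [List.mem_filter, mem_before] at hw
      exact hw.1.2
    · rintro ⟨⟨h1, h2⟩, h3⟩
      rw [List.mem_filter, mem_before, hkey w h1 h2]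
      exact ⟨⟨hLm w, h3⟩, by simpa using h2⟩

theorem share_bounds {N : ℕ} {t' : V → ℕ} (w : V) : 0 ≤ share (t' w / N) ∧ share (t' w / N) ≤ 1 := by
  have h1 := le_share (x := t' w / N) (by positivity)
  have h2 := share_le (x := t' w / N) (by positivity)
  constructor <;> linarith

/-- Both shares are at most 1/2, so a vertex taken passively before its turn gets no less than it
would as an active vertex. -/
theorem share_le_one_sub {N x y : ℕ} : share (x / N : ℝ) ≤ 1 - share (y / N) := by
  have h1 := share_le (x := x / N) (by positivity)
  have h2 := share_le (x := y / N) (by positivity)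
  linarith

theorem share_le_share {N x y : ℕ} (h : x ≤ y) : share (x / N : ℝ) ≤ share (y / N) :=
  share_mono (by positivity) (by gcongr)

variable [Fintype V] [DecidableEq V] (G : SimpleGraph V) [DecidableRel G.Adj] (pl : V → List V)

variable (idx t)

/-- The set of unmatched vertices just before the position `k`, when `v` is deleted and the other
vertices of the list `O` are processed. -/
def stateBefore (O : List V) (v : V) (k : ℕ ×ₗ ℕ) : Finset V :=
  run G pl (Finset.univ.erase v) (before idx t O k)

/-- If `u` is processed at time `x` in the absence of `v`, it finds an unmatched neighbour. -/
def Succeeds (O : List V) (u v : V) (x : ℕ) : Prop :=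
  u ∈ stateBefore idx t G pl O v (toLex (x, idx u)) ∧
    ∃ z, G.Adj u z ∧ z ∈ stateBefore idx t G pl O v (toLex (x, idx u))

variable {idx t G pl}

theorem stateBefore_anti {O : List V} (hO : O.Pairwise fun a b => key idx t a < key idx t b)
    (v : V) {k k' : ℕ ×ₗ ℕ} (hk : k ≤ k') :
    stateBefore idx t G pl O v k' ⊆ stateBefore idx t G pl O v k := by
  obtain ⟨R, hR⟩ := before_append (hO.filter fun w => decide (key idx t w < k')) k
  change before idx t O k' = before idx t (before idx t O k') k ++ R at hR
  rw [before_before hk] at hR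
  rw [stateBefore, hR, run_append]
  exact run_subset _ _

theorem run_subset_stateBefore {O : List V}
    (hO : O.Pairwise fun a b => key idx t a < key idx t b) (v : V) (k : ℕ ×ₗ ℕ) :
    run G pl (Finset.univ.erase v) O ⊆ stateBefore idx t G pl O v k := by
  obtain ⟨R, hR⟩ := before_append hO k
  conv_lhs => rw [hR, run_append]
  exact run_subset _ _

theorem Succeeds.anti {O : List V} (hO : O.Pairwise fun a b => key idx t a < key idx t b)
    {u v : V} {x y : ℕ} (hxy : x ≤ y) (h : Succeeds idx t G pl O u v y) :
    Succeeds idx t G pl O u v x := by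
  have hk : (toLex (x, idx u) : ℕ ×ₗ ℕ) ≤ toLex (y, idx u) := by
    rw [Prod.Lex.toLex_le_toLex]
    rcases hxy.lt_or_eq with h | h
    · exact Or.inl h
    · exact Or.inr ⟨h, le_rfl⟩
  obtain ⟨h1, z, hz, h2⟩ := h
  exact ⟨stateBefore_anti hO v hk h1, z, hz, stateBefore_anti hO v hk h2⟩

variable {N : ℕ} {O L : List V} {u v : V} {t' : V → ℕ}

theorem run_before_eq (hO : O.Pairwise fun a b => key idx t a < key idx t b)
    (hOm : ∀ w, w ∈ O ↔ w ≠ u ∧ w ≠ v) (ht : ∀ w, w ≠ u → w ≠ v → t' w = t w)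
    (hL : L.Pairwise fun a b => key idx t' a < key idx t' b) (hLm : ∀ w, w ∈ L) {k : ℕ ×ₗ ℕ}
    (hk : k ≤ key idx t' u) :
    run G pl (Finset.univ.erase v) (before idx t' L k) = stateBefore idx t G pl O v k := by
  rw [stateBefore, ← before_filter_ne hO hOm ht hL hLm hk,
    run_filter_ne (Finset.notMem_erase v _)]

open Classical in
/-- The guaranteed share of `u`, in terms of the process without `v`. -/
theorem guarantee_le_gain {A : V → Prop} (hA : ∀ u w, G.Adj u w → (A u ↔ ¬ A w))
    (hpl : ∀ u w, w ∈ pl u) (hv : A v) (hu : ¬ A u)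
    (hO : O.Pairwise fun a b => key idx t a < key idx t b)
    (hOm : ∀ w, w ∈ O ↔ w ≠ u ∧ w ≠ v) (ht : ∀ w, w ≠ u → w ≠ v → t' w = t w)
    (hL : L.Pairwise fun a b => key idx t' a < key idx t' b) (hLm : ∀ w, w ∈ L)
    {D : ℕ} (hD : ∀ x < N, Succeeds idx t G pl O u v x ↔ x < D) (huN : t' u < N) :
    guarantee N D (u ∉ run G pl (Finset.univ.erase v) O) (t' u)
      ≤ gain G pl (fun w => share (t' w / N)) Finset.univ L u := by
  have dom : ∀ l, Dominates A (run G pl (Finset.univ.erase v) l) (run G pl Finset.univ l) := by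
    refine Dominates.run hA hpl ⟨fun _ _ _ => Finset.mem_univ _, fun x hx _ => ?_⟩
    refine Finset.mem_erase.2 ⟨?_, Finset.mem_univ _⟩
    rintro rfl
    exact hx hv
  unfold guarantee
  split_ifs with h1 h2
  · obtain ⟨hs, z, hz, hzs⟩ := (hD _ huN).2 h1
    obtain ⟨L₁, L₂, rfl⟩ := List.append_of_mem (hLm u)
    have hrun := run_before_eq (G := G) (pl := pl) hO hOm ht hL hLm le_rfl
    rw [before_key_eq hL] at hrun
    change _ = stateBefore idx t G pl O v (toLex (t' u, idx u)) at hrun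
    rw [← hrun] at hs hzs
    -- Without `v`, `u` is matched by the end of its turn; by domination, the same holds with `v`,
    -- actively or passively.
    have hnot : u ∉ run G pl Finset.univ (L₁ ++ [u]) := by
      intro hmem
      have := (dom (L₁ ++ [u])).2 u hu hmem
      rw [run_append] at this
      have hst : u ∈ step G pl (run G pl (Finset.univ.erase v) L₁) u := this
      rw [mem_step] at hst
      rcases hc : choice G pl (run G pl (Finset.univ.erase v) L₁) u with _ | w
      · exact choice_eq_none (hpl u z) hc hs hz hzs
      · exact (hst.2 w hc).1 rfl
    have hle : L₁ ++ u :: L₂ = (L₁ ++ [u]) ++ L₂ := by simp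
    rw [hle]
    refine le_trans ?_ (le_gain_of_prefix share_bounds _ _ _ _)
    exact le_gain_of_matched share_bounds (Finset.mem_univ _) hnot (fun z _ => share_le_one_sub)
      fun _ => le_rfl
  · exact gain_nonneg share_bounds _ _ _
  · have hDN : D < N := (not_lt.1 h1).trans_lt huN
    have hk : (toLex (D, idx u) : ℕ ×ₗ ℕ) ≤ key idx t' u := by
      rw [key, Prod.Lex.toLex_le_toLex]
      rcases (not_lt.1 h1).lt_or_eq with h | h
      · exact Or.inl h
      · exact Or.inr ⟨h, le_rfl⟩
    have hrun := run_before_eq (G := G) (pl := pl) hO hOm ht hL hLm hk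
    -- If `u` were still unmatched here, failing at time `D` would mean that it has no unmatched
    -- neighbour, so it could never be matched passively.
    have hnS : u ∉ stateBefore idx t G pl O v (toLex (D, idx u)) := by
      intro hmem
      have hns : ¬ Succeeds idx t G pl O u v D := fun h => lt_irrefl _ ((hD D hDN).1 h)
      obtain ⟨R, hR⟩ := before_append hO (toLex (D, idx u))
      apply h2
      rw [hR, run_append]
      exact mem_run_of_isolated hmem (fun w hw hwS => hns ⟨hmem, w, hw, hwS⟩) R
    have hnot : u ∉ run G pl Finset.univ (before idx t' L (toLex (D, idx u))) := by
      intro hmem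
      have := (dom _).2 u hu hmem
      rw [hrun] at this
      exact hnS this
    obtain ⟨R, hR⟩ := before_append hL (toLex (D, idx u))
    conv_rhs => rw [hR]
    refine le_trans ?_ (le_gain_of_prefix share_bounds _ _ _ _)
    refine le_gain_of_matched share_bounds (Finset.mem_univ _) hnot (fun z hz => ?_) fun hz => ?_
    · have := share_le_share (N := N) (time_le_of_key_lt (mem_before.1 hz).2)
      linarith
    · exact absurd (mem_before.1 hz).2 (not_lt.2 hk)

/-- If `u` is processed before `v`, would fail in the absence of `v` and cannot be matched
passively, and `v` is still unmatched, then `u` and `v` are matched with each other. -/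
theorem one_le_gain_of_fails (hpl : ∀ u w, w ∈ pl u) (hadj : G.Adj u v)
    (hO : O.Pairwise fun a b => key idx t a < key idx t b)
    (hOm : ∀ w, w ∈ O ↔ w ≠ u ∧ w ≠ v) (ht : ∀ w, w ≠ u → w ≠ v → t' w = t w)
    (hL : L.Pairwise fun a b => key idx t' a < key idx t' b) (hLm : ∀ w, w ∈ L)
    (huv : t' u < t' v) (hf : ¬ Succeeds idx t G pl O u v (t' u))
    (hu : u ∈ run G pl (Finset.univ.erase v) O)
    (hv : v ∈ stateBefore idx t G pl O u (toLex (t' u, idx u))) :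
    1 ≤ gain G pl (fun w => share (t' w / N)) Finset.univ L u
      + gain G pl (fun w => share (t' w / N)) Finset.univ L v := by
  obtain ⟨L₁, L₂, rfl⟩ := List.append_of_mem (hLm u)
  have hb := before_filter_ne hO hOm ht hL hLm le_rfl
  rw [before_key_eq hL] at hb
  change _ = before idx t O (toLex (t' u, idx u)) at hb
  have hlt : ∀ w ∈ L₁, key idx t' w < key idx t' u := fun w hw =>
    (List.pairwise_append.1 hL).2.2 w hw u List.mem_cons_self
  have huL : u ∉ L₁ := fun h => lt_irrefl _ (hlt u h)
  have hvL : v ∉ L₁ := fun h => by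
    have := time_le_of_key_lt (hlt v h)
    omega
  have hself : L₁.filter (· ≠ v) = L₁ := List.filter_eq_self.2 fun w hw => by
    have : w ≠ v := fun h => hvL (h ▸ hw)
    simpa using this
  rw [hself] at hb
  have hu' : u ∈ stateBefore idx t G pl O v (toLex (t' u, idx u)) :=
    run_subset_stateBefore hO v _ hu
  have hins := run_eq_insert (G := G) (pl := pl) (S := Finset.univ) (Finset.mem_univ u)
    (Finset.mem_univ v) hadj.ne huL hvL (by rw [hb]; exact hu') (by rw [hb]; exact hv)
  apply one_le_gain_add_gain share_bounds
  have hmu : u ∈ run G pl Finset.univ L₁ := by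
    rw [hins, hb]
    exact Finset.mem_insert_of_mem hu'
  have hmv : v ∈ run G pl Finset.univ L₁ := by
    rw [hins]
    exact Finset.mem_insert_self _ _
  rcases hc : choice G pl (run G pl Finset.univ L₁) u with _ | w
  · exact absurd hmv (choice_eq_none (hpl u v) hc hmu hadj)
  · obtain ⟨-, hw, hwm⟩ := choice_eq_some hc
    rw [hins, Finset.mem_insert] at hwm
    rcases hwm with rfl | hwm
    · rfl
    · rw [hb] at hwm
      exact absurd ⟨hu', w, hw, hwm⟩ hf

/-- Success of `v` at time x + 1 shows that it is free at position (x + 1, idx v), hence at the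
earlier (x, idx u). Success at time x would not suffice, because a tie may place `v` before `u`. -/
theorem mem_stateBefore_of_threshold {E x : ℕ}
    (hO : O.Pairwise fun a b => key idx t a < key idx t b)
    (hE : ∀ y < N, Succeeds idx t G pl O v u y ↔ y < E) (hEN : E ≤ N)
    (h : x + 1 < E ∨ v ∈ run G pl (Finset.univ.erase u) O) :
    v ∈ stateBefore idx t G pl O u (toLex (x, idx u)) := by
  rcases h with h | h
  · refine stateBefore_anti hO u ?_ ((hE (x + 1) (by omega)).2 h).1
    rw [Prod.Lex.toLex_le_toLex]
    exact Or.inl x.lt_succ_self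
  · exact run_subset_stateBefore hO u _ h

/-- The average gain of an edge, over the times at which its ends are processed, when the times of
the other vertices are fixed. -/
theorem sum_gain_edge_ge {A : V → Prop} (hA : ∀ u w, G.Adj u w → (A u ↔ ¬ A w))
    (hpl : ∀ u w, w ∈ pl u) (hadj : G.Adj u v) (hN : 0 < N)
    (hO : O.Pairwise fun a b => key idx t a < key idx t b) (hOm : ∀ w, w ∈ O ↔ w ≠ u ∧ w ≠ v)
    (T : ℕ → ℕ → V → ℕ) (hTu : ∀ x y, T x y u = x) (hTv : ∀ x y, T x y v = y)
    (hT : ∀ x y w, w ≠ u → w ≠ v → T x y w = t w) (L : ℕ → ℕ → List V)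
    (hL : ∀ x < N, ∀ y < N, (L x y).Pairwise fun a b => key idx (T x y) a < key idx (T x y) b)
    (hLm : ∀ x < N, ∀ y < N, ∀ w, w ∈ L x y) :
    639 / 1000 * (N : ℝ) ^ 2 - 8 * N ≤ ∑ x ∈ Finset.range N, ∑ y ∈ Finset.range N,
      (gain G pl (fun w => share (T x y w / N)) Finset.univ (L x y) u
        + gain G pl (fun w => share (T x y w / N)) Finset.univ (L x y) v) := by
  classical
  wlog hv : A v generalizing A
  · refine this (A := fun w => ¬ A w) (fun u w h => not_congr (hA u w h)) hv
  have hu : ¬ A u := fun h => (hA u v hadj).1 h hv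
  have hOm' : ∀ w, w ∈ O ↔ w ≠ v ∧ w ≠ u := fun w => by rw [hOm, and_comm]
  obtain ⟨D, hDN, hD⟩ := exists_threshold N (P := Succeeds idx t G pl O u v)
    fun x y hxy h => h.anti hO hxy
  obtain ⟨E, hEN, hE⟩ := exists_threshold N (P := Succeeds idx t G pl O v u)
    fun x y hxy h => h.anti hO hxy
  refine sum_ge_of_thresholds (D := D) (E := E) (p := u ∉ run G pl (Finset.univ.erase v) O)
    (q := v ∉ run G pl (Finset.univ.erase u) O) hN hDN hEN ?_ ?_ ?_
  · intro x hx y hy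
    have h1 := guarantee_le_gain hA hpl hv hu hO hOm (hT x y) (hL x hx y hy) (hLm x hx y hy) hD
      (by rw [hTu]; exact hx)
    have h2 := guarantee_le_gain (A := fun w => ¬ A w) (fun u w h => not_congr (hA u w h)) hpl hu
      (not_not.2 hv) hO hOm' (fun w h1 h2 => hT x y w h2 h1) (hL x hx y hy) (hLm x hx y hy) hE
      (by rw [hTv]; exact hy)
    rw [hTu] at h1
    rw [hTv] at h2
    exact add_le_add h1 h2
  · intro x hx y hy hxy hDx hp hq
    rw [not_not] at hp hq
    refine one_le_gain_of_fails hpl hadj hO hOm (hT x y) (hL x hx y hy) (hLm x hx y hy)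
      (by rwa [hTu, hTv]) ?_ hp ?_
    · rw [hTu, hD x hx]
      omega
    · rw [hTu]
      exact mem_stateBefore_of_threshold hO hE hEN hq
  · intro x hx y hy hyx hEy hq hp
    rw [not_not] at hp hq
    rw [add_comm]
    refine one_le_gain_of_fails hpl hadj.symm hO hOm' (fun w h1 h2 => hT x y w h2 h1)
      (hL x hx y hy) (hLm x hx y hy) (by rwa [hTu, hTv]) ?_ hq ?_
    · rw [hTv, hE y hy]
      omega
    · rw [hTv]
      exact mem_stateBefore_of_threshold hO hD hDN hp

end Thresholds

/-! ### Averaging over times and over tie-breaking orders. -/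

section Average

variable {V : Type*} [Fintype V]

/-- The decision order given by times, ties being broken by a fixed order. -/
def timedOrder (σ : VertexOrder V) (t : V → ℕ) : VertexOrder V := (Tuple.sort (t ∘ σ)).trans σ

theorem timedOrder_pairwise (σ : VertexOrder V) (t : V → ℕ) :
    (List.ofFn (timedOrder σ t)).Pairwise
      fun a b => key (fun w => (σ.symm w : ℕ)) t a < key (fun w => (σ.symm w : ℕ)) t b := by
  rw [List.pairwise_ofFn]
  intro i j hij
  obtain ⟨h1, h2⟩ := (Tuple.eq_sort_iff (f := t ∘ σ)).1 rfl
  rw [key, key, Prod.Lex.toLex_lt_toLex]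
  rcases (h1 hij.le).lt_or_eq with h | h
  · exact Or.inl h
  · refine Or.inr ⟨h, ?_⟩
    simpa [timedOrder] using h2 i j hij h

theorem mem_ofFn_order (σ : VertexOrder V) (w : V) : w ∈ List.ofFn σ := by
  rw [List.mem_ofFn]
  exact σ.surjective w

variable [DecidableEq V]

/-- Resampling one coordinate preserves the uniform measure; this frees the times of the two ends of
an edge while the others stay fixed. -/
theorem sum_sum_update {N : ℕ} (u : V) (F : (V → Fin N) → ℝ) :
    ∑ t, ∑ x, F (Function.update t u x) = N * ∑ t, F t := by
  rw [Finset.sum_comm' (t' := Finset.univ) (s' := fun _ => Finset.univ) (by simp)]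
  have key : ∀ x : Fin N, ∑ t : V → Fin N, F (Function.update t u x)
      = N * ∑ r : {j // j ≠ u} → Fin N, F ((Equiv.funSplitAt u (Fin N)).symm (x, r)) := by
    intro x
    rw [← (Equiv.funSplitAt u (Fin N)).symm.sum_comp, Fintype.sum_prod_type]
    rw [Finset.sum_congr rfl (g := fun _ => ∑ r : {j // j ≠ u} → Fin N,
      F ((Equiv.funSplitAt u (Fin N)).symm (x, r)))]
    · simp
    · intro y _
      refine Finset.sum_congr rfl fun r _ => ?_
      congr 1
      ext w
      by_cases h : w = u
      · subst h
        simp [Equiv.funSplitAt, Equiv.piSplitAt]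
      · simp [Equiv.funSplitAt, Equiv.piSplitAt, h]
  rw [Finset.sum_congr rfl fun x _ => key x, ← Finset.mul_sum]
  congr 1
  rw [← (Equiv.funSplitAt u (Fin N)).symm.sum_comp, Fintype.sum_prod_type]

/-- Averaging over times, and over the order used to break ties, yields the uniform distribution
on the decision orders. -/
theorem sum_timedOrder (N : ℕ) (f : VertexOrder V → ℝ) :
    ∑ σ : VertexOrder V, ∑ t : V → Fin N, f (timedOrder σ fun w => t w)
      = N ^ Fintype.card V * ∑ σ, f σ := by
  -- Indexing times by positions in `σ` makes the sorting permutation independent of `σ`; composing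
  -- with it is then a bijection of the orders.
  have h1 : ∀ σ : VertexOrder V, ∑ t : V → Fin N, f (timedOrder σ fun w => t w)
      = ∑ s : Fin (Fintype.card V) → Fin N, f ((Tuple.sort fun i => (s i : ℕ)).trans σ) := by
    intro σ
    rw [← (Equiv.arrowCongr σ (Equiv.refl (Fin N))).sum_comp]
    refine Finset.sum_congr rfl fun s _ => ?_
    have e : (fun w => ((Equiv.arrowCongr σ (Equiv.refl (Fin N)) s w : Fin N) : ℕ)) ∘ σ
        = fun i => (s i : ℕ) := by
      funext i
      simp
    rw [timedOrder, e]
  rw [Finset.sum_congr rfl fun σ _ => h1 σ, Finset.sum_comm]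
  have h2 : ∀ s : Fin (Fintype.card V) → Fin N,
      ∑ σ : VertexOrder V, f ((Tuple.sort fun i => (s i : ℕ)).trans σ) = ∑ σ, f σ := by
    intro s
    exact (Equiv.equivCongr (Tuple.sort fun i => (s i : ℕ)).symm (Equiv.refl V)).sum_comp f
  rw [Finset.sum_congr rfl fun s _ => h2 s]
  simp

variable {G : SimpleGraph V} [DecidableRel G.Adj]

theorem sum_gain_edge_timed_ge {A : V → Prop} (hA : ∀ u w, G.Adj u w → (A u ↔ ¬ A w))
    {pl : V → List V} (hpl : ∀ u w, w ∈ pl u) {u v : V} (hadj : G.Adj u v) {N : ℕ} (hN : 0 < N)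
    (σ : VertexOrder V) :
    (N : ℝ) ^ Fintype.card V * (639 / 1000 * (N : ℝ) ^ 2 - 8 * N) ≤ (N : ℝ) * (N *
      ∑ t : V → Fin N, (gain G pl (fun w => share (t w / N)) Finset.univ
          (List.ofFn (timedOrder σ fun w => t w)) u
        + gain G pl (fun w => share (t w / N)) Finset.univ
          (List.ofFn (timedOrder σ fun w => t w)) v)) := by
  set F : (V → ℕ) → ℝ := fun t => gain G pl (fun w => share (t w / N)) Finset.univ
      (List.ofFn (timedOrder σ t)) u
    + gain G pl (fun w => share (t w / N)) Finset.univ (List.ofFn (timedOrder σ t)) v with hF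
  change _ ≤ (N : ℝ) * (N * ∑ t : V → Fin N, F fun w => t w)
  rw [← sum_sum_update v (fun t : V → Fin N => F fun w => t w),
    ← sum_sum_update u (fun t : V → Fin N => ∑ y, F fun w => Function.update t v y w)]
  have hcard : (N : ℝ) ^ Fintype.card V * (639 / 1000 * (N : ℝ) ^ 2 - 8 * N)
      = ∑ t : V → Fin N, (639 / 1000 * (N : ℝ) ^ 2 - 8 * N) := by
    rw [Finset.sum_const, nsmul_eq_mul, Finset.card_univ, Fintype.card_fun, Fintype.card_fin]
    push_cast
    rfl
  rw [hcard]
  refine Finset.sum_le_sum fun t _ => ?_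
  set T : ℕ → ℕ → V → ℕ := fun x y w => if w = u then x else if w = v then y else t w with hT
  have huv := hadj.ne
  have h := sum_gain_edge_ge (G := G) (pl := pl) (u := u) (v := v) (N := N)
    (t := fun w => (t w : ℕ)) (idx := fun w => (σ.symm w : ℕ)) hA hpl hadj hN
    (O := (List.ofFn (timedOrder σ fun w => t w)).filter fun w => w ≠ u ∧ w ≠ v)
    ((timedOrder_pairwise σ _).filter _)
    (fun w => by
      rw [List.mem_filter, decide_eq_true_eq]
      exact and_iff_right (mem_ofFn_order _ w))
    T (fun x y => by simp [hT]) (fun x y => by simp [hT, huv.symm])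
    (fun x y w h1 h2 => by simp [hT, h1, h2]) (fun x y => List.ofFn (timedOrder σ (T x y)))
    (fun x _ y _ => timedOrder_pairwise σ _) (fun x _ y _ w => mem_ofFn_order _ w)
  refine h.trans (le_of_eq ?_)
  rw [Finset.sum_range]
  refine Finset.sum_congr rfl fun x _ => ?_
  rw [Finset.sum_range]
  refine Finset.sum_congr rfl fun y _ => ?_
  have e : T x y = fun w => ((Function.update (Function.update t u x) v y w : Fin N) : ℕ) := by
    ext w
    by_cases h1 : w = u
    · subst h1
      simp [hT, huv]
    · by_cases h2 : w = v
      · subst h2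
        simp [hT, h1]
      · simp [hT, h1, h2]
  rw [← e]

/-- Distinct edges of a matching have disjoint ends, so no share is counted twice, and the shares of
uncovered vertices are nonnegative. -/
theorem sum_gain_edges_le {c : V → ℝ} (hc : ∀ x, 0 ≤ c x ∧ c x ≤ 1) {pl : V → List V}
    {M : G.Subgraph} (hM : M.IsMatching) (L : List V) (s : Finset (Sym2 V))
    (hs : ∀ e ∈ s, e ∈ M.edgeSet) :
    ∑ e ∈ s, ∑ x ∈ e.toFinset, gain G pl c Finset.univ L x ≤ size G pl Finset.univ L := by
  rw [← sum_gain (c := c), ← Finset.sum_biUnion]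
  · exact Finset.sum_le_sum_of_subset_of_nonneg (Finset.subset_univ _)
      fun x _ _ => gain_nonneg hc _ _ _
  · intro e he e' he' hne
    rw [Function.onFun, Finset.disjoint_left]
    intro x hx hx'
    rw [Sym2.mem_toFinset] at hx hx'
    obtain ⟨y, rfl⟩ := hx
    obtain ⟨y', rfl⟩ := hx'
    have h1 : M.Adj x y := hs _ he
    have h2 : M.Adj x y' := hs _ he'
    exact hne (by rw [hM.eq_of_adj_left h1 h2])

theorem rdoExpectedSize_ge (hG : G.IsBipartite) (pref : V → VertexOrder V) {M : G.Subgraph}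
    (hM : M.IsMatching) {N : ℕ} (hN : 0 < N) :
    (639 / 1000 - 8 / N) * (M.edgeSet.ncard : ℝ) ≤ rdoExpectedSize G pref := by
  classical
  obtain ⟨col⟩ := hG
  have hA : ∀ u w, G.Adj u w → (col u = 0 ↔ ¬ col w = 0) := by
    intro u w h
    have := col.valid h
    omega
  have hN' : (0 : ℝ) < N := by exact_mod_cast hN
  set pl : V → List V := fun u => List.ofFn (pref u) with hpl'
  have hpl : ∀ u w, w ∈ pl u := fun u w => mem_ofFn_order _ w
  set s : Finset (Sym2 V) := M.edgeSet.toFinset with hs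
  set f : VertexOrder V → ℝ := fun σ => ((rdoMatching G pref σ).card : ℝ) with hf
  have hm : M.edgeSet.ncard = s.card := Set.ncard_eq_toFinset_card' _
  have key : ∀ σ : VertexOrder V, s.card * ((N : ℝ) ^ Fintype.card V *
      (639 / 1000 * (N : ℝ) ^ 2 - 8 * N))
      ≤ N * (N * ∑ t : V → Fin N, f (timedOrder σ fun w => t w)) := by
    intro σ
    have h1 : ∀ t : V → Fin N, ∑ e ∈ s, ∑ x ∈ e.toFinset, gain G pl (fun w => share (t w / N))
        Finset.univ (List.ofFn (timedOrder σ fun w => t w)) x ≤ f (timedOrder σ fun w => t w) := by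
      intro t
      rw [hf]
      simp only [card_rdoMatching]
      exact sum_gain_edges_le (share_bounds (t' := fun w => (t w : ℕ))) hM _ s
        fun e he => by simpa [hs] using he
    have h2 := Finset.sum_le_sum fun t (_ : t ∈ (Finset.univ : Finset (V → Fin N))) => h1 t
    have h3 := mul_le_mul_of_nonneg_left (mul_le_mul_of_nonneg_left h2 hN'.le) hN'.le
    refine le_trans ?_ h3
    rw [Finset.sum_comm, Finset.mul_sum, Finset.mul_sum, ← nsmul_eq_mul]
    refine Finset.card_nsmul_le_sum _ _ _ fun e he => ?_
    induction e with | _ u v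
    have hadj : M.Adj u v := by simpa [hs] using he
    have h4 := sum_gain_edge_timed_ge hA hpl (M.adj_sub hadj) hN σ
    refine h4.trans (le_of_eq ?_)
    congr 2
    refine Finset.sum_congr rfl fun t _ => ?_
    rw [Sym2.toFinset_mk_eq, Finset.sum_pair (M.adj_sub hadj).ne]
  have hsum := Finset.sum_le_sum fun σ (_ : σ ∈ (Finset.univ : Finset (VertexOrder V))) => key σ
  rw [Finset.sum_const, nsmul_eq_mul, ← Finset.mul_sum, ← Finset.mul_sum, sum_timedOrder] at hsum
  have hc : (0 : ℝ) < (Finset.univ : Finset (VertexOrder V)).card := by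
    have : 0 < Fintype.card (VertexOrder V) :=
      Fintype.card_pos_iff.2 ⟨(Fintype.equivFin V).symm⟩
    exact_mod_cast this
  rw [rdoExpectedSize, Finset.expect_eq_sum_div_card, le_div_iff₀ hc, hm]
  have hp : (0 : ℝ) < N ^ Fintype.card V * (N * N) := by positivity
  refine le_of_mul_le_mul_left ?_ hp
  refine le_trans (le_of_eq ?_) (hsum.trans (le_of_eq ?_))
  · field_simp
  · ring

end Average

end ObliviousMatching

theorem theorem1 {V : Type*} [Fintype V] [DecidableEq V] (G : SimpleGraph V) [DecidableRel G.Adj]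
    (hG : G.IsBipartite) (pref : V → ObliviousMatching.VertexOrder V)
    (Mstar : G.Subgraph) (hMstar : ObliviousMatching.IsMaximumMatching Mstar) :
    (0.639 : ℝ) * (Mstar.edgeSet.ncard : ℝ) ≤ ObliviousMatching.rdoExpectedSize G pref := by
  refine le_of_forall_pos_sub_le fun ε hε => ?_
  -- With this N the discretisation loss, 8/N per edge of the maximum matching, totals at most `ε`.
  obtain ⟨N, hN⟩ := exists_nat_gt (8 * (Mstar.edgeSet.ncard : ℝ) / ε)
  have hN0 : (0 : ℝ) < N := lt_of_le_of_lt (by positivity) hN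
  have h := ObliviousMatching.rdoExpectedSize_ge hG pref hMstar.1 (N := N) (by exact_mod_cast hN0)
  rw [div_lt_iff₀ hε] at hN
  have e : 8 / N * (Mstar.edgeSet.ncard : ℝ) ≤ ε := by
    rw [div_mul_eq_mul_div, div_le_iff₀ hN0]
    linarith
  linarith
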